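/- Theorem 3.1 (Ampliation homogeneity). Let $\mathscr H$ be a separable complex Hilbert space. For $1 \le p \le \infty$ and a compact operator $T$ on a Hilbert space put $$|T|_p^- = \sum_{j=1}^{\infty} s_j\, j^{-1+1/p} \in [0,\infty],$$ where $1/\infty = 0$ and $s_1 \ge s_2 \ge \dots$ are the eigenvalues of $|T| = (T^*T)^{1/2}$ in decreasing order, repeated according to multiplicity and followed by zeros if there are only finitely many positive ones (this is the norm of the Lorentz $(p,1)$ ideal). For an $n$-tuple $\tau = (T_i)_{1\le i\le n}$ of bounded operators on a Hilbert space, let $$k_p^-(\tau) = \liminf_{A} \ \max_{1 \le i \le n} \big|T_iA - AT_i\big|_p^- \in [0,\infty],$$ where $A$ runs over the finite rank operators with $0 \le A \le I$, directed by the usual order of self-adjoint operators. Then for every $n$-tuple $\tau = (T_i)_{1\le i\le n}$ of bounded operators on $\mathscr H$, every $1 \le p \le \infty$ and every integer $m \ge 1$, $$k_p^-(\tau \otimes I_m) = m^{1/p}\, k_p^-(\tau),$$ where $\tau \otimes I_m = (T_i \otimes I_m)_{1\le i\le n}$ acts on $\mathscr H \otimes \mathbb C^m \cong \mathscr H \oplus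 \dots \oplus \mathscr H$ ($m$ summands), $m^{1/\infty} = 1$ and $m^{1/p}\cdot\infty = \infty$. -/

import Mathlib

open scoped ENNReal NNReal

noncomputable section

namespace QuasicentralModulus

variable {H : Type*} [NormedAddCommGroup H] [InnerProductSpace ℂ H]

/-- The span of all eigenvectors of the modulus `|T| = (T* T)^{1/2}` for eigenvalues `≥ t`.
Since eigenspaces for distinct eigenvalues are independent, its dimension is the number of
eigenvalues of `|T|` in `[t, ∞)`, counted with multiplicity. -/
def upperEigenspace [CompleteSpace H] (T : H →L[ℂ] H) (t : ℝ≥0) : Submodule ℂ H :=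
  ⨆ l : ℝ≥0, ⨆ _ : t ≤ l,
    Module.End.eigenspace ((CFC.abs T : H →L[ℂ] H) : H →ₗ[ℂ] H) ((l : ℝ) : ℂ)

/-- For `j ≥ 1` and a compact operator `T`, the `j`-th term `s_j` of the decreasing list
`s_1 ≥ s_2 ≥ …` of the eigenvalues of `|T|`, repeated according to multiplicity (and followed by
zeros if `|T|` has fewer than `j` positive eigenvalues): the largest `t` such that at least `j`
eigenvalues, counted with multiplicity, are `≥ t`. -/
def singularNumber [CompleteSpace H] (T : H →L[ℂ] H) (j : ℕ) : ℝ≥0∞ :=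
  ⨆ t : ℝ≥0, ⨆ _ : (j : Cardinal) ≤ Module.rank ℂ (upperEigenspace T t), (t : ℝ≥0∞)

open Classical in
/-- The norm of the `(p,1)` Lorentz ideal, `|T|_p^- = ∑_{j ≥ 1} s_j j^{-1+1/p}` (with `1/∞ = 0`),
for a compact operator `T`, as an element of `[0,∞]`. The ideal consists of the `T` for which the
value is finite; operators that are not compact get the value `∞`. -/
def lorentzNorm [CompleteSpace H] (p : ℝ≥0∞) (T : H →L[ℂ] H) : ℝ≥0∞ :=
  if IsCompactOperator T then
    ∑' j : ℕ, singularNumber T (j + 1) * ((j + 1 : ℕ) : ℝ≥0∞) ^ (-1 + (p⁻¹).toReal)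
  else ∞

variable (H) in
/-- The finite rank positive contractions `0 ≤ A ≤ I`, with the usual order of operators. -/
abbrev FiniteRankPosContraction : Type _ :=
  {A : H →L[ℂ] H // FiniteDimensional ℂ (LinearMap.range (A : H →ₗ[ℂ] H)) ∧ 0 ≤ A ∧ A ≤ 1}

/-- The commutator `[τ, A] = ([T_i, A])_i` of an `n`-tuple with an operator. -/
def tupleCommutator {n : ℕ} (τ : Fin n → H →L[ℂ] H) (A : H →L[ℂ] H) : Fin n → H →L[ℂ] H :=
  fun i => τ i * A - A * τ i

/-- The norm of an `n`-tuple: the maximum of the norms of its entries. -/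
def tupleNorm {n : ℕ} (N : (H →L[ℂ] H) → ℝ≥0∞) (τ : Fin n → H →L[ℂ] H) : ℝ≥0∞ :=
  ⨆ i, N (τ i)

/-- The quasicentral modulus of an `n`-tuple `τ` for the (extended) norm `N` of a normed ideal:
the lower limit of `|[τ, A]|` along the finite rank positive contractions `A`, ordered by the
usual order of operators. -/
def quasicentralModulus {n : ℕ} (N : (H →L[ℂ] H) → ℝ≥0∞) (τ : Fin n → H →L[ℂ] H) : ℝ≥0∞ :=
  Filter.liminf (fun A : FiniteRankPosContraction H => tupleNorm N (tupleCommutator τ A.1))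
    Filter.atTop

/-- The quasicentral modulus `k_p^-(τ)` for the `(p,1)` Lorentz ideal. -/
def kMinus [CompleteSpace H] (p : ℝ≥0∞) {n : ℕ} (τ : Fin n → H →L[ℂ] H) : ℝ≥0∞ :=
  quasicentralModulus (lorentzNorm p) τ

/-- The operator `T ⊗ I_m` on `H ⊗ ℂ^m`, identified with the Hilbert space direct sum
`H ⊕ ⋯ ⊕ H` of `m` copies of `H`: it acts as `T` on each summand. -/
def ampliation (m : ℕ) (T : H →L[ℂ] H) :
    PiLp 2 (fun _ : Fin m => H) →L[ℂ] PiLp 2 (fun _ : Fin m => H) :=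
  (PiLp.continuousLinearEquiv 2 ℂ (fun _ : Fin m => H)).symm.toContinuousLinearMap ∘L
    (ContinuousLinearMap.pi fun i => T ∘L ContinuousLinearMap.proj i) ∘L
      (PiLp.continuousLinearEquiv 2 ℂ (fun _ : Fin m => H)).toContinuousLinearMap

theorem ampliation_apply (m : ℕ) (T : H →L[ℂ] H) (x : PiLp 2 (fun _ : Fin m => H)) (i : Fin m) :
    ampliation m T x i = T (x i) := rfl

end QuasicentralModulus

end

/-! Both inequalities rest on the numbers `∑ i < m, w (i + m * j)`, the weights `w j = (j + 1) ^ (-1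
+ 1/p)` summed over the `j`-th block of length `m`. Such a sum is at least `m^(1/p) * w j`, and at
most `1 + 1/M` times that once `j ≥ M ≥ 1`.

For `≥`, averaging the diagonal blocks of `B ≥ A₀ ⊗ I` gives an admissible operator above `A₀`, and
turns commutators with `T ⊗ I` into commutators with `T`. This average shrinks the Lorentz norm by
the factor `m^(1/p)` (`rpow_mul_lorentzNorm_blockAverage_le`), because the norm dominates `∑ w a *
|⟪f a, Y (e a)⟫|` for all orthonormal systems.

For `≤`, test with `A ⊗ I`. The singular values of `X ⊗ I` are those of `X`, each repeated `m`
times, so the norm of `X ⊗ I` is at most about `m^(1/p)` times that of `X`, up to an error `m * M *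
‖X‖` from the first `M` blocks (`lorentzNorm_ampliation_le`). The error disappears because the
commutators can be made small in operator norm at no cost in Lorentz norm: average many admissible
`A`, each the identity on a large subspace fixed by its predecessors. Their commutators have
orthogonal supports, so the sum stays bounded in operator norm while convexity controls the Lorentz
norm (`exists_norm_commutator_le`). -/

noncomputable section

namespace QuasicentralModulus

open scoped InnerProductSpace InnerProduct
open Module

/-- A singular value decomposition `T = ∑ j, s j • ⟪e j, ·⟫ f j` of a finite rank operator, with
decreasing singular values `s`, extended by zero. -/
structure IsSVD {H : Type*} [NormedAddCommGroup H] [InnerProductSpace ℂ H] (T : H →L[ℂ] H)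
    {r : ℕ} (s : ℕ → ℝ) (e f : Fin r → H) : Prop where
  anti : Antitone s
  zero : ∀ j, r ≤ j → s j = 0
  left : Orthonormal ℂ e
  right : Orthonormal ℂ f
  apply : ∀ x, T x = ∑ j : Fin r, ((s j : ℂ) * ⟪e j, x⟫_ℂ) • f j

/-- Finite rank operators. -/
def IsFiniteRank {H : Type*} [NormedAddCommGroup H] [InnerProductSpace ℂ H] (T : H →L[ℂ] H) :
    Prop :=
  FiniteDimensional ℂ (LinearMap.range (T : H →ₗ[ℂ] H))

/-! ### Rearrangement and Abel summation inequalities. -/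

/-- Bathtub principle: subtract the level `s k`. What exceeds it lives on the indices below `k`, and
the rest costs at most `s k * k`. -/
theorem sum_mul_le_sum_range {s : ℕ → ℝ} (hs : Antitone s) {r : ℕ} {d : Fin r → ℝ}
    (hd0 : ∀ j, 0 ≤ d j) (hd1 : ∀ j, d j ≤ 1) {k : ℕ} (hd : ∑ j, d j ≤ k) (hk : 0 ≤ s k) :
    ∑ j : Fin r, s j * d j ≤ ∑ j ∈ Finset.range k, s j := by
  have h1 : ∑ j : Fin r, s j * d j ≤ ∑ j : Fin r, max (s j - s k) 0 + s k * ∑ j, d j := by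
    rw [Finset.mul_sum, ← Finset.sum_add_distrib]
    refine Finset.sum_le_sum fun j _ => ?_
    have h2 : (s j - s k) * d j ≤ max (s j - s k) 0 * d j :=
      mul_le_mul_of_nonneg_right (le_max_left _ _) (hd0 j)
    have h3 : max (s j - s k) 0 * d j ≤ max (s j - s k) 0 :=
      mul_le_of_le_one_right (le_max_right _ _) (hd1 j)
    linarith
  have h2 : ∑ j : Fin r, max (s j - s k) 0 ≤ ∑ j ∈ Finset.range k, (s j - s k) := by
    rw [Fin.sum_univ_eq_sum_range (fun j => max (s j - s k) 0) r]
    calc ∑ j ∈ Finset.range r, max (s j - s k) 0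
        ≤ ∑ j ∈ Finset.range (max r k), max (s j - s k) 0 :=
          Finset.sum_le_sum_of_subset_of_nonneg (by simp) fun _ _ _ => le_max_right _ _
      _ = ∑ j ∈ Finset.range k, max (s j - s k) 0 := by
          refine (Finset.sum_subset (by simp) fun j _ hj => ?_).symm
          exact max_eq_right (sub_nonpos.mpr (hs (by simpa using hj)))
      _ = ∑ j ∈ Finset.range k, (s j - s k) :=
          Finset.sum_congr rfl fun j hj =>
            max_eq_left (sub_nonneg.mpr (hs (Finset.mem_range.mp hj).le))
  rw [Finset.sum_sub_distrib, Finset.sum_const, Finset.card_range, nsmul_eq_mul] at h2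
  have h3 := mul_le_mul_of_nonneg_left hd hk
  linarith

theorem sum_range_mul_le_of_partial_sums_le {w c s : ℕ → ℝ} (hw : Antitone w) (hw0 : ∀ j, 0 ≤ w j)
    {N : ℕ} (h : ∀ k ≤ N, ∑ j ∈ Finset.range k, c j ≤ ∑ j ∈ Finset.range k, s j) :
    ∑ j ∈ Finset.range N, w j * c j ≤ ∑ j ∈ Finset.range N, w j * s j := by
  -- Abel summation as an induction; the boundary term on the left is what makes the step close.
  have key : ∀ k ≤ N, w k * (∑ j ∈ Finset.range k, s j - ∑ j ∈ Finset.range k, c j) ≤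
      ∑ j ∈ Finset.range k, w j * s j - ∑ j ∈ Finset.range k, w j * c j := by
    intro k
    induction k with
    | zero => simp
    | succ k ih =>
      intro hk
      have h1 := ih (by omega)
      have h2 := mul_le_mul_of_nonneg_right (hw k.le_succ) (sub_nonneg.mpr (h (k + 1) hk))
      refine h2.trans ?_
      simp only [Finset.sum_range_succ]
      linarith
  have h1 := mul_nonneg (hw0 N) (sub_nonneg.mpr (h N le_rfl))
  linarith [key N le_rfl]

variable {H : Type*} [NormedAddCommGroup H] [InnerProductSpace ℂ H]

/-! ### Finite rank operators and their singular value decompositions. -/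

theorem IsSVD.nonneg {T : H →L[ℂ] H} {r : ℕ} {s : ℕ → ℝ} {e f : Fin r → H} (h : IsSVD T s e f)
    (j : ℕ) : 0 ≤ s j := by
  have := h.anti (le_max_left j r)
  rwa [h.zero _ (le_max_right j r)] at this

theorem IsSVD.inner_apply {T : H →L[ℂ] H} {r : ℕ} {s : ℕ → ℝ} {e f : Fin r → H}
    (h : IsSVD T s e f) (j : Fin r) : ⟪f j, T (e j)⟫_ℂ = s j := by
  simp [h.apply, orthonormal_iff_ite.mp h.left, h.right.1]

theorem IsSVD.apply_left {T : H →L[ℂ] H} {r : ℕ} {s : ℕ → ℝ} {e f : Fin r → H}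
    (h : IsSVD T s e f) (j : Fin r) : T (e j) = (s j : ℂ) • f j := by
  simp [h.apply, orthonormal_iff_ite.mp h.left]

theorem IsSVD.le_opNorm {T : H →L[ℂ] H} {r : ℕ} {s : ℕ → ℝ} {e f : Fin r → H}
    (h : IsSVD T s e f) (j : ℕ) : s j ≤ ‖T‖ := by
  rcases lt_or_ge j r with hj | hj
  · have h1 := T.le_opNorm (e ⟨j, hj⟩)
    rw [h.apply_left, norm_smul, h.left.1, h.right.1] at h1
    simpa [abs_of_nonneg (h.nonneg j)] using h1
  · rw [h.zero j hj]; positivity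

theorem IsFiniteRank.isCompactOperator {T : H →L[ℂ] H} (hT : IsFiniteRank T) :
    IsCompactOperator T := by
  have : FiniteDimensional ℂ (LinearMap.range (T : H →ₗ[ℂ] H)) := hT
  have : LocallyCompactSpace (LinearMap.range (T : H →ₗ[ℂ] H)) :=
    have := FiniteDimensional.proper ℂ (LinearMap.range (T : H →ₗ[ℂ] H))
    inferInstance
  let R : H →L[ℂ] (LinearMap.range (T : H →ₗ[ℂ] H)) := T.codRestrict _ fun x => ⟨x, rfl⟩
  have hR : IsCompactOperator (R : H → LinearMap.range (T : H →ₗ[ℂ] H)) :=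
    isCompactOperator_of_locallyCompactSpace_dom R
  exact hR.clm_comp (LinearMap.range (T : H →ₗ[ℂ] H)).subtypeL

theorem IsFiniteRank.of_range_le {S T : H →L[ℂ] H} (hT : IsFiniteRank T)
    (h : LinearMap.range (S : H →ₗ[ℂ] H) ≤ LinearMap.range (T : H →ₗ[ℂ] H)) : IsFiniteRank S := by
  have : FiniteDimensional ℂ (LinearMap.range (T : H →ₗ[ℂ] H)) := hT
  exact Submodule.finiteDimensional_of_le h

theorem IsFiniteRank.add {S T : H →L[ℂ] H} (hS : IsFiniteRank S) (hT : IsFiniteRank T) :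
    IsFiniteRank (S + T) := by
  have : FiniteDimensional ℂ (LinearMap.range (S : H →ₗ[ℂ] H)) := hS
  have : FiniteDimensional ℂ (LinearMap.range (T : H →ₗ[ℂ] H)) := hT
  refine Submodule.finiteDimensional_of_le (S₂ := LinearMap.range (S : H →ₗ[ℂ] H) ⊔
    LinearMap.range (T : H →ₗ[ℂ] H)) ?_
  rintro _ ⟨x, rfl⟩
  exact Submodule.add_mem_sup ⟨x, rfl⟩ ⟨x, rfl⟩

theorem IsFiniteRank.mul_right {S : H →L[ℂ] H} (hS : IsFiniteRank S) (T : H →L[ℂ] H) :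
    IsFiniteRank (S * T) :=
  hS.of_range_le (by rintro _ ⟨x, rfl⟩; exact ⟨T x, rfl⟩)

theorem IsFiniteRank.mul_left {S : H →L[ℂ] H} (hS : IsFiniteRank S) (T : H →L[ℂ] H) :
    IsFiniteRank (T * S) := by
  have : FiniteDimensional ℂ (LinearMap.range (S : H →ₗ[ℂ] H)) := hS
  refine Submodule.finiteDimensional_of_le (S₂ := (LinearMap.range (S : H →ₗ[ℂ] H)).map
    (T : H →ₗ[ℂ] H)) ?_
  rintro _ ⟨x, rfl⟩
  exact ⟨S x, ⟨x, rfl⟩, rfl⟩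

theorem IsFiniteRank.smul {S : H →L[ℂ] H} (hS : IsFiniteRank S) (c : ℝ) :
    IsFiniteRank (c • S) :=
  hS.of_range_le (by rintro _ ⟨x, rfl⟩; exact ⟨(c : ℂ) • x, by simp⟩)

theorem IsFiniteRank.sub {S T : H →L[ℂ] H} (hS : IsFiniteRank S) (hT : IsFiniteRank T) :
    IsFiniteRank (S - T) := by
  have := hS.add (hT.smul (-1))
  rwa [neg_one_smul, ← sub_eq_add_neg] at this

theorem IsFiniteRank.commutator {A : H →L[ℂ] H} (hA : IsFiniteRank A) (T : H →L[ℂ] H) :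
    IsFiniteRank (T * A - A * T) :=
  (hA.mul_left T).sub (hA.mul_right T)

/-- Ky Fan's inequality. The arithmetic-geometric mean inequality bounds the products of
coefficients by the matrix `D`, whose row and column sums are at most 1 by Bessel; the bathtub
principle then applies. -/
theorem IsSVD.sum_norm_inner_le {T : H →L[ℂ] H} {r : ℕ} {s : ℕ → ℝ} {e f : Fin r → H}
    (h : IsSVD T s e f) {k : ℕ} {e' f' : Fin k → H} (he : Orthonormal ℂ e')
    (hf : Orthonormal ℂ f') :
    ∑ a, ‖⟪f' a, T (e' a)⟫_ℂ‖ ≤ ∑ j ∈ Finset.range k, s j := by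
  let D : Fin r → Fin k → ℝ := fun j a => (‖⟪e j, e' a⟫_ℂ‖ ^ 2 + ‖⟪f j, f' a⟫_ℂ‖ ^ 2) / 2
  have hD : ∀ j a, 0 ≤ D j a := fun j a => by positivity
  have h1 : ∀ a, ‖⟪f' a, T (e' a)⟫_ℂ‖ ≤ ∑ j : Fin r, s j * D j a := by
    intro a
    rw [h.apply, inner_sum]
    refine (norm_sum_le _ _).trans (Finset.sum_le_sum fun j _ => ?_)
    rw [inner_smul_right, norm_mul, norm_mul, Complex.norm_real, Real.norm_eq_abs,
      abs_of_nonneg (h.nonneg j), mul_assoc, norm_inner_symm (f' a)]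
    refine mul_le_mul_of_nonneg_left ?_ (h.nonneg j)
    have := two_mul_le_add_sq ‖⟪e j, e' a⟫_ℂ‖ ‖⟪f j, f' a⟫_ℂ‖
    simp only [D]; linarith
  calc ∑ a, ‖⟪f' a, T (e' a)⟫_ℂ‖ ≤ ∑ a, ∑ j : Fin r, s j * D j a :=
        Finset.sum_le_sum fun a _ => h1 a
    _ = ∑ j : Fin r, s j * ∑ a, D j a := by
        rw [Finset.sum_comm]; simp_rw [Finset.mul_sum]
    _ ≤ ∑ j ∈ Finset.range k, s j := by
        refine sum_mul_le_sum_range h.anti (fun j => Finset.sum_nonneg fun a _ => hD j a)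
          (fun j => ?_) ?_ (h.nonneg k)
        · have h2 := he.sum_inner_products_le (e j) (s := Finset.univ)
          have h3 := hf.sum_inner_products_le (f j) (s := Finset.univ)
          rw [h.left.1] at h2
          rw [h.right.1] at h3
          simp_rw [norm_inner_symm _ (e j)] at h2
          simp_rw [norm_inner_symm _ (f j)] at h3
          simp only [D, ← Finset.sum_div, Finset.sum_add_distrib]
          linarith
        · rw [Finset.sum_comm]
          have h4 : ∀ a ∈ (Finset.univ : Finset (Fin k)), ∑ j, D j a ≤ 1 := fun a _ => by
            have h2 := h.left.sum_inner_products_le (e' a) (s := Finset.univ)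
            have h3 := h.right.sum_inner_products_le (f' a) (s := Finset.univ)
            rw [he.1] at h2
            rw [hf.1] at h3
            simp only [D, ← Finset.sum_div, Finset.sum_add_distrib]
            linarith
          simpa using Finset.sum_le_card_nsmul _ _ _ h4

/-! ### Ampliations. -/

theorem inner_single_left {m : ℕ} (i : Fin m) (x : H) (y : PiLp 2 (fun _ : Fin m => H)) :
    ⟪PiLp.single 2 i x, y⟫_ℂ = ⟪x, y i⟫_ℂ := by
  rw [PiLp.inner_apply, Finset.sum_eq_single i]
  · rw [PiLp.single_eq_same]
  · intro j _ hj
    rw [PiLp.single_eq_of_ne 2 hj, inner_zero_left]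
  · simp

theorem orthonormal_single {m r : ℕ} {e : Fin r → H} (he : Orthonormal ℂ e) :
    Orthonormal ℂ (fun x : Fin r × Fin m =>
      (PiLp.single 2 x.2 (e x.1) : PiLp 2 (fun _ : Fin m => H))) := by
  rw [orthonormal_iff_ite]
  rintro ⟨j, i⟩ ⟨j', i'⟩
  rw [inner_single_left]
  by_cases hi : i = i'
  · subst hi
    rw [PiLp.single_eq_same, orthonormal_iff_ite.mp he]
    simp
  · rw [PiLp.single_eq_of_ne 2 hi, inner_zero_right, if_neg]
    simp [hi]

theorem sum_finProdFinEquiv {M : Type*} [AddCommMonoid M] {r m : ℕ} (g : Fin (r * m) → M) :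
    ∑ k, g k = ∑ j : Fin r, ∑ i : Fin m, g (finProdFinEquiv (j, i)) := by
  rw [← Fintype.sum_prod_type', ← finProdFinEquiv.sum_comp]

/-- Under `finProdFinEquiv` the pair `(j, i)` has index `i + m * j`, so the quotient by `m` recovers
`j` and the list stays decreasing. -/
theorem IsSVD.ampliation {T : H →L[ℂ] H} {r : ℕ} {s : ℕ → ℝ} {e f : Fin r → H}
    (h : IsSVD T s e f) {m : ℕ} (hm : 1 ≤ m) :
    IsSVD (ampliation m T) (fun k => s (k / m))
      (fun k : Fin (r * m) =>
        PiLp.single 2 (finProdFinEquiv.symm k).2 (e (finProdFinEquiv.symm k).1))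
      (fun k : Fin (r * m) =>
        PiLp.single 2 (finProdFinEquiv.symm k).2 (f (finProdFinEquiv.symm k).1)) where
  anti := fun a b hab => h.anti (Nat.div_le_div_right hab)
  zero := fun k hk => h.zero _ ((Nat.le_div_iff_mul_le hm).mpr hk)
  left := (orthonormal_single h.left).comp _ finProdFinEquiv.symm.injective
  right := (orthonormal_single h.right).comp _ finProdFinEquiv.symm.injective
  apply := fun x => by
    have hdiv : ∀ (j : Fin r) (i : Fin m),
        ((finProdFinEquiv (j, i) : Fin (r * m)) : ℕ) / m = j := fun j i => by
      rw [finProdFinEquiv_apply_val, Nat.add_mul_div_left _ _ hm, Nat.div_eq_of_lt i.2, zero_add]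
    ext i'
    rw [ampliation_apply, h.apply, sum_finProdFinEquiv]
    simp only [Equiv.symm_apply_apply, inner_single_left, hdiv]
    rw [WithLp.ofLp_sum, Finset.sum_apply]
    refine Finset.sum_congr rfl fun j _ => ?_
    rw [WithLp.ofLp_sum, Finset.sum_apply, Finset.sum_eq_single i']
    · rw [PiLp.smul_apply, PiLp.single_eq_same]
    · intro i _ hi
      rw [PiLp.smul_apply, PiLp.single_eq_of_ne' 2 hi, smul_zero]
    · simp

theorem IsSVD.isFiniteRank {T : H →L[ℂ] H} {r : ℕ} {s : ℕ → ℝ} {e f : Fin r → H}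
    (h : IsSVD T s e f) : IsFiniteRank T := by
  have : FiniteDimensional ℂ (Submodule.span ℂ (Set.range f)) :=
    FiniteDimensional.span_of_finite ℂ (Set.finite_range f)
  refine Submodule.finiteDimensional_of_le (S₂ := Submodule.span ℂ (Set.range f)) ?_
  rintro _ ⟨x, rfl⟩
  have : (T : H →ₗ[ℂ] H) x = T x := rfl
  rw [this, h.apply]
  exact Submodule.sum_mem _ fun j _ => Submodule.smul_mem _ _ (Submodule.subset_span ⟨j, rfl⟩)

theorem ampliation_single {m : ℕ} (T : H →L[ℂ] H) (i : Fin m) (x : H) :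
    ampliation m T (PiLp.single 2 i x) = PiLp.single 2 i (T x) := by
  ext j
  rw [ampliation_apply]
  by_cases h : j = i
  · subst h; rw [PiLp.single_eq_same, PiLp.single_eq_same]
  · rw [PiLp.single_eq_of_ne 2 h, PiLp.single_eq_of_ne 2 h, map_zero]

theorem ampliation_one (m : ℕ) : ampliation m (1 : H →L[ℂ] H) = 1 := rfl

theorem ampliation_sub (m : ℕ) (S T : H →L[ℂ] H) :
    ampliation m (S - T) = ampliation m S - ampliation m T := rfl

theorem ampliation_mul (m : ℕ) (S T : H →L[ℂ] H) :
    ampliation m (S * T) = ampliation m S * ampliation m T := rfl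

theorem ampliation_nonneg (m : ℕ) {T : H →L[ℂ] H} (hT : 0 ≤ T) : 0 ≤ ampliation m T := by
  rw [ContinuousLinearMap.nonneg_iff_isPositive, ContinuousLinearMap.isPositive_def] at *
  refine ⟨fun x y => ?_, fun x => ?_⟩
  · rw [PiLp.inner_apply, PiLp.inner_apply]
    exact Finset.sum_congr rfl fun i _ => hT.1 (x i) (y i)
  · rw [ContinuousLinearMap.reApplyInnerSelf_apply, PiLp.inner_apply, map_sum]
    exact Finset.sum_nonneg fun i _ => hT.2 (x i)

/-- Addition in `Fin m` is cyclic, so a shift by `c` only permutes the summands. -/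
theorem orthonormal_shifted_single {m r : ℕ} [NeZero m] {g : Fin r → H} (hg : Orthonormal ℂ g)
    (c : Fin m) : Orthonormal ℂ (fun k : Fin (r * m) =>
      (PiLp.single 2 ((finProdFinEquiv.symm k).2 + c) (g (finProdFinEquiv.symm k).1) :
        PiLp 2 (fun _ : Fin m => H))) := by
  have hinj : Function.Injective fun k : Fin (r * m) =>
      ((finProdFinEquiv.symm k).1, (finProdFinEquiv.symm k).2 + c) := by
    intro a b hab
    simp only [Prod.mk.injEq, add_left_inj] at hab
    exact finProdFinEquiv.symm.injective (Prod.ext hab.1 hab.2)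
  have h := (orthonormal_single (m := m) hg).comp _ hinj
  exact h

variable [CompleteSpace H]

/-! ### Existence of decompositions, and their agreement with the eigenvalues of the modulus. -/

/-- The operator restricts to an injection `G` from the orthogonal complement of its kernel to its
range, both finite dimensional. Diagonalising `G* G` gives the `e j`; injectivity makes every `s j`
positive, so `f j` may be defined by division. -/
theorem exists_isSVD (T : H →L[ℂ] H) (hT : IsFiniteRank T) :
    ∃ (r : ℕ) (s : ℕ → ℝ) (e f : Fin r → H), IsSVD T s e f := by
  let K : Submodule ℂ H := LinearMap.ker (T : H →ₗ[ℂ] H)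
  have hK : IsClosed (K : Set H) := T.isClosed_ker
  have : CompleteSpace K := hK.completeSpace_coe
  let R := LinearMap.range (T : H →ₗ[ℂ] H)
  have : FiniteDimensional ℂ R := hT
  let G : Kᗮ →ₗ[ℂ] R := (T : H →ₗ[ℂ] H).rangeRestrict ∘ₗ Kᗮ.subtype
  have hGc : ∀ x : Kᗮ, ((G x : R) : H) = T x := fun x => rfl
  have hG : Function.Injective G := by
    rw [← LinearMap.ker_eq_bot, LinearMap.ker_eq_bot']
    intro x hx
    have h1 : (x : H) ∈ K := by
      have := congrArg (fun y : R => (y : H)) hx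
      simpa [hGc, K] using this
    have h2 := Submodule.inner_right_of_mem_orthogonal h1 x.2
    exact Subtype.ext (inner_self_eq_zero.mp h2)
  have : FiniteDimensional ℂ Kᗮ := FiniteDimensional.of_injective G hG
  let hS := G.isSymmetric_adjoint_comp_self
  let r := finrank ℂ Kᗮ
  let b := hS.eigenvectorBasis (n := r) rfl
  let s : ℕ → ℝ := fun j => G.singularValues j
  have hpos : ∀ j : Fin r, 0 < s j := fun j =>
    (G.injective_iff_forall_lt_finrank_singularValues_pos.mp hG) j j.2
  have hin : ∀ i j : Fin r, ⟪T (b i), T (b j)⟫_ℂ = if i = j then ((s j : ℂ)) ^ 2 else 0 := by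
    intro i j
    have h1 : ⟪T (b i), T (b j)⟫_ℂ = ⟪G (b i), G (b j)⟫_ℂ := rfl
    rw [h1, ← LinearMap.adjoint_inner_right]
    have h2 := hS.apply_eigenvectorBasis rfl j
    have h3 := G.sq_singularValues_fin rfl j
    rw [LinearMap.comp_apply] at h2
    have h4 : LinearMap.adjoint G (G (b j)) = ((s j : ℂ)^2) • b j := by
      refine h2.trans ?_
      congr 1
      rw [← h3]; simp [s]
    rw [h4, inner_smul_right, orthonormal_iff_ite.mp b.orthonormal]
    simp
  refine ⟨r, s, fun j => (b j : H), fun j => ((s j : ℂ)⁻¹) • T (b j), ?_, ?_, ?_, ?_, ?_⟩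
  · exact G.singularValues_antitone
  · intro j hj; exact G.singularValues_of_finrank_le hj
  · exact b.orthonormal.comp_linearIsometry (Kᗮ).subtypeₗᵢ
  · rw [orthonormal_iff_ite]
    intro i j
    rw [inner_smul_left, inner_smul_right, hin]
    have := (hpos j).ne'
    split_ifs with hij
    · subst hij
      have h' : (s i : ℂ) ≠ 0 := by exact_mod_cast this
      simp; field_simp
    · simp
  · intro x
    have h1 : T x = T (Kᗮ.orthogonalProjectionOnto x : H) := by
      have h2 : x - (Kᗮ.orthogonalProjectionOnto x : H) ∈ K := by
        have := Submodule.sub_starProjection_mem_orthogonal (K := Kᗮ) x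
        rwa [Submodule.orthogonal_orthogonal] at this
      have h3 : T (x - (Kᗮ.orthogonalProjectionOnto x : H)) = 0 := h2
      rw [map_sub, sub_eq_zero] at h3
      exact h3
    have h2 := b.sum_repr' (Kᗮ.orthogonalProjectionOnto x)
    rw [h1, ← h2]
    simp only [AddSubmonoidClass.coe_finsetSum, map_sum, Submodule.coe_smul, map_smul]
    refine Finset.sum_congr rfl fun j _ => ?_
    have h' : (s j : ℂ) ≠ 0 := by exact_mod_cast (hpos j).ne'
    rw [smul_smul, mul_right_comm, mul_inv_cancel₀ h', one_mul]
    congr 1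
    exact Submodule.inner_orthogonalProjectionOnto_eq_of_mem_left (b j) x

open InnerProductSpace in
-- The right-hand side is a positive operator with square `T* T`, and positive square roots are
-- unique.
theorem IsSVD.abs_apply {T : H →L[ℂ] H} {r : ℕ} {s : ℕ → ℝ} {e f : Fin r → H}
    (h : IsSVD T s e f) (x : H) :
    (CFC.abs T : H →L[ℂ] H) x = ∑ j : Fin r, ((s j : ℂ) * ⟪e j, x⟫_ℂ) • e j := by
  let P : H →L[ℂ] H := ∑ j : Fin r, (s j : ℂ) • rankOne ℂ (e j) (e j)
  have hPx : ∀ x, P x = ∑ j : Fin r, ((s j : ℂ) * ⟪e j, x⟫_ℂ) • e j := fun x => by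
    simp [P, mul_smul]
  have hP : 0 ≤ P := by
    rw [ContinuousLinearMap.nonneg_iff_isPositive]
    refine ContinuousLinearMap.isPositive_sum _ fun j _ => ?_
    refine (isPositive_rankOne_self (e j)).smul_of_nonneg ?_
    exact_mod_cast h.nonneg j
  have hPP : P * P = star T * T := by
    ext x
    refine ext_inner_left ℂ fun y => ?_
    have h1 : ⟪y, (star T * T) x⟫_ℂ = ⟪T y, T x⟫_ℂ := by
      rw [ContinuousLinearMap.star_eq_adjoint, mul_apply_eq_comp,
        ContinuousLinearMap.adjoint_inner_right]
    have h2 : ⟪y, (P * P) x⟫_ℂ = ⟪P y, P x⟫_ℂ := by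
      rw [mul_apply_eq_comp]
      exact ((ContinuousLinearMap.nonneg_iff_isPositive P).mp hP).isSymmetric y (P x) |>.symm
    rw [h1, h2, hPx, hPx, h.apply, h.apply]
    have := h.left.inner_sum (fun j : Fin r => (s j : ℂ) * ⟪e j, y⟫_ℂ)
      (fun j : Fin r => (s j : ℂ) * ⟪e j, x⟫_ℂ) Finset.univ
    rw [this]
    exact (h.right.inner_sum _ _ _).symm
  rw [← hPx, CFC.abs, CFC.sqrt_unique hPP hP]

/-- Positivity of `t` keeps the kernel out: an eigenvector `x` equals `l⁻¹ |T| x`, hence lies in the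
span of the `e j`, and only those with `s j = l` contribute. -/
theorem IsSVD.upperEigenspace_eq {T : H →L[ℂ] H} {r : ℕ} {s : ℕ → ℝ} {e f : Fin r → H}
    (h : IsSVD T s e f) {t : ℝ≥0} (ht : 0 < t) :
    upperEigenspace T t = Submodule.span ℂ (e '' {j | (t : ℝ) ≤ s j}) := by
  apply le_antisymm
  · refine iSup₂_le fun l hl x hx => ?_
    rw [Module.End.mem_eigenspace_iff] at hx
    replace hx : (CFC.abs T : H →L[ℂ] H) x = ((l : ℝ) : ℂ) • x := hx
    rw [h.abs_apply] at hx
    have hl0 : ((l : ℝ) : ℂ) ≠ 0 := by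
      have : 0 < l := ht.trans_le hl
      exact_mod_cast this.ne'
    have hx' : x = ((l : ℝ) : ℂ)⁻¹ • ∑ j : Fin r, ((s j : ℂ) * ⟪e j, x⟫_ℂ) • e j := by
      rw [hx, inv_smul_smul₀ hl0]
    rw [hx']
    refine Submodule.smul_mem _ _ (Submodule.sum_mem _ fun j _ => ?_)
    by_cases hj : (t : ℝ) ≤ s j
    · exact Submodule.smul_mem _ _ (Submodule.subset_span ⟨j, hj, rfl⟩)
    · have h1 : (s j : ℂ) * ⟪e j, x⟫_ℂ = ((l : ℝ) : ℂ) * ⟪e j, x⟫_ℂ := by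
        have := congrArg (fun y => ⟪e j, y⟫_ℂ) hx
        simpa [inner_sum, inner_smul_right, orthonormal_iff_ite.mp h.left] using this
      have h2 : (s j : ℂ) ≠ ((l : ℝ) : ℂ) := by
        intro h3
        have h3' : s j = l := by exact_mod_cast h3
        exact hj (h3' ▸ (by exact_mod_cast hl))
      have h3 : ⟪e j, x⟫_ℂ = 0 := by
        by_contra h4
        exact h2 (mul_right_cancel₀ h4 h1)
      simp [h3]
  · rw [Submodule.span_le]
    rintro _ ⟨j, hj, rfl⟩
    have hle : t ≤ (s j).toNNReal := by
      rw [← NNReal.coe_le_coe, Real.coe_toNNReal _ (h.nonneg j)]; exact hj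
    refine Submodule.mem_iSup_of_mem (s j).toNNReal (Submodule.mem_iSup_of_mem hle ?_)
    rw [Module.End.mem_eigenspace_iff, Real.coe_toNNReal _ (h.nonneg j)]
    refine (h.abs_apply (e j)).trans ?_
    simp [orthonormal_iff_ite.mp h.left]

/-- The indices with `s i ≥ t` form an initial segment; it has `j + 1` elements exactly when it
contains `j`. -/
theorem IsSVD.rank_upperEigenspace {T : H →L[ℂ] H} {r : ℕ} {s : ℕ → ℝ} {e f : Fin r → H}
    (h : IsSVD T s e f) {t : ℝ≥0} (ht : 0 < t) (j : ℕ) :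
    ((j + 1 : ℕ) : Cardinal) ≤ Module.rank ℂ (upperEigenspace T t) ↔ (t : ℝ) ≤ s j := by
  classical
  have hli : LinearIndependent ℂ e := h.left.linearIndependent
  have hrank : Module.rank ℂ (upperEigenspace T t) =
      ((Finset.univ.filter fun i : Fin r => (t : ℝ) ≤ s i).card : ℕ) := by
    rw [h.upperEigenspace_eq ht,
      rank_span_set (hli.linearIndepOn_id.mono (Set.image_subset_range _ _))]
    have himg : e '' {i | (t : ℝ) ≤ s i} =
        ↑((Finset.univ.filter fun i : Fin r => (t : ℝ) ≤ s i).image e) := by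
      ext; simp
    rw [himg]
    refine (Cardinal.mk_coe_finset ..).trans ?_
    rw [Finset.card_image_of_injective _ hli.injective]
  rw [hrank, Nat.cast_le]
  constructor
  · intro hc
    by_contra hlt
    have hsub : (Finset.univ.filter fun i : Fin r => (t : ℝ) ≤ s i).map Fin.valEmbedding ⊆
        Finset.range j := by
      intro i hi
      simp only [Finset.mem_map, Finset.mem_filter, Finset.mem_univ, true_and] at hi
      obtain ⟨a, ha, rfl⟩ := hi
      rw [Finset.mem_range]
      by_contra hge
      exact hlt (ha.trans (h.anti (not_lt.mp hge)))
    have := Finset.card_le_card hsub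
    rw [Finset.card_map, Finset.card_range] at this
    omega
  · intro hts
    have hjr : j < r := by
      by_contra hge
      rw [h.zero j (not_lt.mp hge)] at hts
      exact absurd hts (not_le.mpr (by exact_mod_cast ht))
    have hsub : Finset.range (j + 1) ⊆
        (Finset.univ.filter fun i : Fin r => (t : ℝ) ≤ s i).map Fin.valEmbedding := by
      intro i hi
      rw [Finset.mem_range] at hi
      simp only [Finset.mem_map, Finset.mem_filter, Finset.mem_univ, true_and]
      exact ⟨⟨i, by omega⟩, hts.trans (h.anti (by simp; omega)), rfl⟩
    have := Finset.card_le_card hsub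
    rwa [Finset.card_map, Finset.card_range] at this

theorem IsSVD.singularNumber_eq {T : H →L[ℂ] H} {r : ℕ} {s : ℕ → ℝ} {e f : Fin r → H}
    (h : IsSVD T s e f) (j : ℕ) : singularNumber T (j + 1) = ENNReal.ofReal (s j) := by
  apply le_antisymm
  · refine iSup₂_le fun t ht => ?_
    rcases eq_or_lt_of_le (zero_le (a := t)) with h0 | h0
    · simp [← h0]
    · rw [← ENNReal.ofReal_coe_nnreal]
      exact ENNReal.ofReal_le_ofReal ((h.rank_upperEigenspace h0 j).mp ht)
  · rcases eq_or_lt_of_le (h.nonneg j) with h0 | h0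
    · simp [← h0]
    · have h1 : 0 < (s j).toNNReal := Real.toNNReal_pos.mpr h0
      refine le_iSup₂_of_le (s j).toNNReal ?_ le_rfl
      rw [h.rank_upperEigenspace h1, Real.coe_toNNReal _ h0.le]

/-! ### The Lorentz norm on finite rank operators, in variational form. -/

/-- The weight `(j + 1) ^ (-1 + 1/p)` in the norm of the Lorentz ideal `(p, 1)`. -/
def weight (p : ℝ≥0∞) (j : ℕ) : ℝ := ((j + 1 : ℕ) : ℝ) ^ (-1 + (p⁻¹).toReal)

theorem lorentzNorm_eq_of_isSVD (p : ℝ≥0∞) {T : H →L[ℂ] H} (hT : IsFiniteRank T) {r : ℕ}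
    {s : ℕ → ℝ} {e f : Fin r → H} (h : IsSVD T s e f) {N : ℕ} (hN : r ≤ N) :
    lorentzNorm p T = ENNReal.ofReal (∑ j ∈ Finset.range N, weight p j * s j) := by
  rw [lorentzNorm, if_pos (IsFiniteRank.isCompactOperator hT), tsum_eq_sum (s := Finset.range N),
    ENNReal.ofReal_sum_of_nonneg]
  · refine Finset.sum_congr rfl fun j _ => ?_
    rw [h.singularNumber_eq, mul_comm, weight, ENNReal.ofReal_mul (by positivity)]
    congr 1
    rw [← ENNReal.ofReal_rpow_of_pos (by positivity), ENNReal.ofReal_natCast]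
  · intro j _
    exact mul_nonneg (by unfold weight; positivity) (h.nonneg j)
  · intro j hj
    rw [h.singularNumber_eq, h.zero j (hN.trans (by simpa using hj))]
    simp

theorem weight_nonneg (p : ℝ≥0∞) (j : ℕ) : 0 ≤ weight p j := by unfold weight; positivity

theorem inv_toReal_le_one {p : ℝ≥0∞} (hp : 1 ≤ p) : (p⁻¹).toReal ≤ 1 := by
  have h : p⁻¹ ≤ 1 := ENNReal.inv_le_one.mpr hp
  simpa using ENNReal.toReal_mono ENNReal.one_ne_top h

theorem weight_antitone {p : ℝ≥0∞} (hp : 1 ≤ p) : Antitone (weight p) := by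
  intro i j hij
  refine Real.rpow_le_rpow_of_nonpos (by positivity) (by exact_mod_cast Nat.succ_le_succ hij) ?_
  linarith [inv_toReal_le_one hp]

/-- Ky Fan's inequality for each initial piece of the systems, combined by Abel summation against
the decreasing weights. -/
theorem sum_weight_mul_norm_inner_le_lorentzNorm {p : ℝ≥0∞} (hp : 1 ≤ p) {T : H →L[ℂ] H}
    (hT : IsFiniteRank T) {k : ℕ} {e' f' : Fin k → H} (he : Orthonormal ℂ e')
    (hf : Orthonormal ℂ f') :
    ENNReal.ofReal (∑ a : Fin k, weight p a * ‖⟪f' a, T (e' a)⟫_ℂ‖) ≤ lorentzNorm p T := by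
  obtain ⟨r, s, e, f, h⟩ := exists_isSVD T hT
  rw [lorentzNorm_eq_of_isSVD p hT h (le_max_left r k)]
  refine ENNReal.ofReal_le_ofReal ?_
  let c : ℕ → ℝ := fun a => if ha : a < k then ‖⟪f' ⟨a, ha⟩, T (e' ⟨a, ha⟩)⟫_ℂ‖ else 0
  have hc : ∀ a : Fin k, weight p a * ‖⟪f' a, T (e' a)⟫_ℂ‖ = weight p a * c a := fun a => by
    simp [c]
  rw [Finset.sum_congr rfl fun a _ => hc a, Fin.sum_univ_eq_sum_range (fun a => weight p a * c a)]
  refine (sum_range_mul_le_of_partial_sums_le (s := s) (weight_antitone hp) (weight_nonneg p)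
    fun l hl => ?_).trans ?_
  · rw [← Fin.sum_univ_eq_sum_range c]
    have h1 := h.sum_norm_inner_le (he.comp _ (Fin.castLE_injective hl))
      (hf.comp _ (Fin.castLE_injective hl))
    refine le_trans (le_of_eq (Finset.sum_congr rfl fun a _ => ?_)) h1
    simp [c, a.2.trans_le hl, Fin.castLE]
  · exact Finset.sum_le_sum_of_subset_of_nonneg (by simp)
      fun j _ _ => mul_nonneg (weight_nonneg p j) (h.nonneg j)

/-- The variational bound is attained at the singular vectors, so the norm is a maximum of
seminorms; subadditivity follows. -/
theorem exists_lorentzNorm_eq_sum_weight_mul_norm_inner (p : ℝ≥0∞) {T : H →L[ℂ] H}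
    (hT : IsFiniteRank T) :
    ∃ (r : ℕ) (e f : Fin r → H), Orthonormal ℂ e ∧ Orthonormal ℂ f ∧
      lorentzNorm p T = ENNReal.ofReal (∑ a : Fin r, weight p a * ‖⟪f a, T (e a)⟫_ℂ‖) := by
  obtain ⟨r, s, e, f, h⟩ := exists_isSVD T hT
  refine ⟨r, e, f, h.left, h.right, ?_⟩
  rw [lorentzNorm_eq_of_isSVD p hT h le_rfl,
    ← Fin.sum_univ_eq_sum_range (fun a => weight p a * s a)]
  congr 1
  refine Finset.sum_congr rfl fun a _ => ?_
  rw [h.inner_apply, Complex.norm_real, Real.norm_eq_abs, abs_of_nonneg (h.nonneg _)]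

theorem lorentzNorm_add_le {p : ℝ≥0∞} (hp : 1 ≤ p) {S T : H →L[ℂ] H} (hS : IsFiniteRank S)
    (hT : IsFiniteRank T) : lorentzNorm p (S + T) ≤ lorentzNorm p S + lorentzNorm p T := by
  obtain ⟨r, e, f, he, hf, h⟩ := exists_lorentzNorm_eq_sum_weight_mul_norm_inner p (hS.add hT)
  have h1 := sum_weight_mul_norm_inner_le_lorentzNorm hp hS he hf
  have h2 := sum_weight_mul_norm_inner_le_lorentzNorm hp hT he hf
  have hn : ∀ R : H →L[ℂ] H, 0 ≤ ∑ a : Fin r, weight p a * ‖⟪f a, R (e a)⟫_ℂ‖ := fun R =>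
    Finset.sum_nonneg fun a _ => mul_nonneg (weight_nonneg p a) (norm_nonneg _)
  refine h.le.trans (le_trans ?_ (add_le_add h1 h2))
  rw [← ENNReal.ofReal_add (hn S) (hn T), ← Finset.sum_add_distrib]
  refine ENNReal.ofReal_le_ofReal (Finset.sum_le_sum fun a _ => ?_)
  rw [← mul_add]
  refine mul_le_mul_of_nonneg_left ?_ (weight_nonneg p a)
  rw [add_apply, inner_add_right]
  exact norm_add_le _ _

theorem lorentzNorm_smul_le {p : ℝ≥0∞} (hp : 1 ≤ p) {T : H →L[ℂ] H} (hT : IsFiniteRank T)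
    {c : ℝ} (hc : 0 ≤ c) : lorentzNorm p (c • T) ≤ ENNReal.ofReal c * lorentzNorm p T := by
  obtain ⟨r, e, f, he, hf, h⟩ := exists_lorentzNorm_eq_sum_weight_mul_norm_inner p (hT.smul c)
  refine h.le.trans (le_trans (le_of_eq ?_)
    (mul_le_mul_right (sum_weight_mul_norm_inner_le_lorentzNorm hp hT he hf) _))
  rw [← ENNReal.ofReal_mul hc, Finset.mul_sum]
  congr 1
  refine Finset.sum_congr rfl fun a _ => ?_
  have : ⟪f a, (c • T) (e a)⟫_ℂ = (c : ℂ) * ⟪f a, T (e a)⟫_ℂ := by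
    rw [← inner_smul_right, Complex.coe_smul]; rfl
  rw [this, norm_mul, Complex.norm_real, Real.norm_eq_abs, abs_of_nonneg hc]
  ring

theorem IsFiniteRank.ampliation {T : H →L[ℂ] H} (hT : IsFiniteRank T) {m : ℕ} (hm : 1 ≤ m) :
    IsFiniteRank (ampliation m T) := by
  obtain ⟨r, s, e, f, h⟩ := exists_isSVD T hT
  exact (h.ampliation hm).isFiniteRank

/-! ### Block sums of weights and the norm of an ampliation. -/

theorem weight_le_one {p : ℝ≥0∞} (hp : 1 ≤ p) (j : ℕ) : weight p j ≤ 1 := by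
  refine (weight_antitone hp (Nat.zero_le j)).trans ?_
  simp [weight]

/-- Every weight in the block is at least the last one, `(m * (j + 1)) ^ (-1 + 1/p)`. -/
theorem rpow_mul_weight_le_sum {p : ℝ≥0∞} (hp : 1 ≤ p) {m : ℕ} (hm : 1 ≤ m) (j : ℕ) :
    (m : ℝ) ^ (p⁻¹).toReal * weight p j ≤ ∑ i : Fin m, weight p (i + m * j) := by
  have hm0 : (0 : ℝ) < m := by exact_mod_cast hm
  have h1 : ∀ i ∈ (Finset.univ : Finset (Fin m)),
      ((m : ℝ) * ((j + 1 : ℕ) : ℝ)) ^ (-1 + (p⁻¹).toReal) ≤ weight p (i + m * j) := by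
    intro i _
    refine Real.rpow_le_rpow_of_nonpos (by positivity) ?_ (by linarith [inv_toReal_le_one hp])
    have : (i : ℕ) + m * j + 1 ≤ m * (j + 1) := by
      have := i.2
      rw [mul_add]; omega
    exact_mod_cast this
  refine le_trans (le_of_eq ?_) (Finset.card_nsmul_le_sum _ _ _ h1)
  rw [Finset.card_univ, Fintype.card_fin, nsmul_eq_mul, Real.mul_rpow hm0.le (by positivity),
    ← mul_assoc]
  congr 1
  rw [Real.rpow_add hm0, Real.rpow_neg_one, mul_inv_cancel_left₀ hm0.ne']

theorem sum_weight_le {p : ℝ≥0∞} {m : ℕ} (hm : 1 ≤ m) {M j : ℕ} (hM : 1 ≤ M)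
    (hj : M ≤ j) :
    ∑ i : Fin m, weight p (i + m * j) ≤
      (1 + (M : ℝ)⁻¹) * ((m : ℝ) ^ (p⁻¹).toReal * weight p j) := by
  have hm0 : (0 : ℝ) < m := by exact_mod_cast hm
  have hM0 : (0 : ℝ) < M := by exact_mod_cast hM
  have hjM : (M : ℝ) ≤ j := by exact_mod_cast hj
  have h1 : ∀ i ∈ (Finset.univ : Finset (Fin m)), weight p (i + m * j) ≤
      (1 + (M : ℝ)⁻¹) * ((m : ℝ) * ((j + 1 : ℕ) : ℝ)) ^ (-1 + (p⁻¹).toReal) := by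
    intro i _
    set x : ℝ := ((i + m * j + 1 : ℕ) : ℝ) with hx
    set y : ℝ := (m : ℝ) * ((j + 1 : ℕ) : ℝ) with hy
    have hx0 : 0 < x := by rw [hx]; positivity
    have hy0 : 0 < y := by rw [hy]; positivity
    have hxy : x ≤ y := by
      have : (i : ℕ) + m * j + 1 ≤ m * (j + 1) := by
        have := i.2
        rw [mul_add]; omega
      rw [hx, hy]
      exact_mod_cast this
    -- Here `y ≤ m * j + m`, with `m * j ≤ x` and `m ≤ m * j / M` since `M ≤ j`.
    have hyx : y / x ≤ 1 + (M : ℝ)⁻¹ := by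
      rw [div_le_iff₀ hx0]
      have h2 : (m : ℝ) * j ≤ x := by
        rw [hx]; push_cast; linarith [(Nat.cast_nonneg i.1 : (0 : ℝ) ≤ _)]
      have h3 : (m : ℝ) ≤ (M : ℝ)⁻¹ * (m * j) := by
        rw [inv_mul_eq_div, le_div_iff₀ hM0]
        exact mul_le_mul_of_nonneg_left hjM hm0.le
      have h4 := mul_le_mul_of_nonneg_left h2 (inv_nonneg.mpr hM0.le)
      rw [hy]; push_cast
      linarith
    have hle : x ^ (-1 + (p⁻¹).toReal) = (y / x) ^ (1 - (p⁻¹).toReal) *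
        y ^ (-1 + (p⁻¹).toReal) := by
      rw [Real.div_rpow hy0.le hx0.le, div_mul_eq_mul_div, ← Real.rpow_add hy0]
      rw [show 1 - (p⁻¹).toReal + (-1 + (p⁻¹).toReal) = 0 by ring, Real.rpow_zero, one_div,
        ← Real.rpow_neg hx0.le]
      congr 1; ring
    have hw : weight p (i + m * j) = x ^ (-1 + (p⁻¹).toReal) := rfl
    rw [hw, hle]
    refine mul_le_mul_of_nonneg_right (le_trans ?_ hyx) (by positivity)
    refine (Real.rpow_le_rpow_of_exponent_le ((one_le_div hx0).mpr hxy) (y := 1 - (p⁻¹).toReal)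
      (z := 1) ?_).trans (le_of_eq (Real.rpow_one _))
    linarith [(ENNReal.toReal_nonneg : 0 ≤ (p⁻¹).toReal)]
  refine (Finset.sum_le_card_nsmul _ _ _ h1).trans (le_of_eq ?_)
  rw [Finset.card_univ, Fintype.card_fin, nsmul_eq_mul, Real.mul_rpow hm0.le (by positivity),
    weight, Real.rpow_add hm0, Real.rpow_neg_one]
  field_simp

theorem lorentzNorm_ampliation_le {p : ℝ≥0∞} (hp : 1 ≤ p) {T : H →L[ℂ] H} (hT : IsFiniteRank T)
    {m : ℕ} (hm : 1 ≤ m) {M : ℕ} (hM : 1 ≤ M) :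
    lorentzNorm p (ampliation m T) ≤ ENNReal.ofReal (m * M * ‖T‖) +
      ENNReal.ofReal (1 + (M : ℝ)⁻¹) * ((m : ℝ≥0∞) ^ (p⁻¹).toReal * lorentzNorm p T) := by
  obtain ⟨r, s, e, f, h⟩ := exists_isSVD T hT
  have hm0 : (0 : ℝ) < m := by exact_mod_cast hm
  have hsum0 : 0 ≤ ∑ j ∈ Finset.range r, weight p j * s j :=
    Finset.sum_nonneg fun j _ => mul_nonneg (weight_nonneg p j) (h.nonneg j)
  rw [lorentzNorm_eq_of_isSVD p hT h le_rfl,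
    lorentzNorm_eq_of_isSVD p (hT.ampliation hm) (h.ampliation hm) le_rfl,
    ← ENNReal.ofReal_natCast m, ENNReal.ofReal_rpow_of_pos hm0,
    ← ENNReal.ofReal_mul (by positivity), ← ENNReal.ofReal_mul (by positivity),
    ← ENNReal.ofReal_add (by positivity) (by positivity)]
  refine ENNReal.ofReal_le_ofReal ?_
  rw [← Fin.sum_univ_eq_sum_range (fun k => weight p k * s (k / m)), sum_finProdFinEquiv]
  have h1 : ∀ j : Fin r, ∑ i : Fin m,
      weight p (finProdFinEquiv (j, i) : Fin (r * m)) *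
        s ((finProdFinEquiv (j, i) : Fin (r * m)) / m)
      = (∑ i : Fin m, weight p (i + m * j)) * s j := fun j => by
    rw [Finset.sum_mul]
    refine Finset.sum_congr rfl fun i _ => ?_
    rw [finProdFinEquiv_apply_val, Nat.add_mul_div_left _ _ hm, Nat.div_eq_of_lt i.2, zero_add]
  rw [Finset.sum_congr rfl fun j _ => h1 j,
    Fin.sum_univ_eq_sum_range (fun j => (∑ i : Fin m, weight p (i + m * j)) * s j)]
  -- Blocks below `M` are estimated by the operator norm with weights at most 1, the others by the
  -- block sum estimate.
  have h2 : ∀ j ∈ Finset.range r, (∑ i : Fin m, weight p (i + m * j)) * s j ≤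
      (if j < M then m * ‖T‖ else 0) +
        (1 + (M : ℝ)⁻¹) * ((m : ℝ) ^ (p⁻¹).toReal * (weight p j * s j)) := by
    intro j _
    have hs := h.nonneg j
    have hw := weight_nonneg p j
    split_ifs with hj
    · refine le_trans ?_ (le_add_of_nonneg_right (by positivity))
      refine mul_le_mul ?_ (h.le_opNorm j) hs hm0.le
      simpa using Finset.sum_le_card_nsmul (Finset.univ : Finset (Fin m))
        (fun i : Fin m => weight p (i + m * j)) 1 fun i _ => weight_le_one hp _
    · rw [zero_add]
      refine (mul_le_mul_of_nonneg_right (sum_weight_le hm hM (not_lt.mp hj)) hs).trans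
        (le_of_eq (by ring))
  refine (Finset.sum_le_sum h2).trans ?_
  rw [Finset.sum_add_distrib, ← Finset.mul_sum, ← Finset.mul_sum]
  refine add_le_add ?_ le_rfl
  rw [← Finset.sum_filter, Finset.sum_const, nsmul_eq_mul]
  have hc : ((Finset.range r).filter (· < M)).card ≤ M := by
    refine (Finset.card_le_card fun j hj => ?_).trans (Finset.card_range M).le
    exact Finset.mem_range.mpr (Finset.mem_filter.mp hj).2
  have hc' : (((Finset.range r).filter (· < M)).card : ℝ) ≤ M := by exact_mod_cast hc
  calc _ ≤ (M : ℝ) * (m * ‖T‖) := mul_le_mul_of_nonneg_right hc' (by positivity)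
    _ = _ := by ring

/-! ### Averaging the diagonal blocks. -/

/-- The average `m⁻¹ ∑ i, Y_ii` of the diagonal blocks of an operator on `H ⊕ ⋯ ⊕ H`. -/
def blockAverage (m : ℕ)
    (Y : PiLp 2 (fun _ : Fin m => H) →L[ℂ] PiLp 2 (fun _ : Fin m => H)) : H →L[ℂ] H :=
  (m : ℝ)⁻¹ • ∑ i : Fin m, (PiLp.proj 2 (fun _ : Fin m => H) i : _ →L[ℂ] H) ∘L Y ∘L
    (PiLp.proj 2 (fun _ : Fin m => H) i : _ →L[ℂ] H)†

theorem adjoint_proj_apply {m : ℕ} (i : Fin m) (x : H) :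
    ((PiLp.proj 2 (fun _ : Fin m => H) i : _ →L[ℂ] H)†) x = PiLp.single 2 i x := by
  refine ext_inner_right ℂ fun y => ?_
  rw [ContinuousLinearMap.adjoint_inner_left, inner_single_left]
  rfl

theorem blockAverage_apply {m : ℕ}
    (Y : PiLp 2 (fun _ : Fin m => H) →L[ℂ] PiLp 2 (fun _ : Fin m => H)) (x : H) :
    blockAverage m Y x = (m : ℝ)⁻¹ • ∑ i : Fin m, (Y (PiLp.single 2 i x)) i := by
  simp [blockAverage, adjoint_proj_apply]

theorem blockAverage_sub {m : ℕ}
    (Y Z : PiLp 2 (fun _ : Fin m => H) →L[ℂ] PiLp 2 (fun _ : Fin m => H)) :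
    blockAverage m (Y - Z) = blockAverage m Y - blockAverage m Z := by
  ext x
  simp [blockAverage_apply, smul_sub]

/-- With its right-handed companion, this makes the average a bimodule map over the operators `T ⊗
I`, so it respects commutators with them. -/
theorem blockAverage_ampliation_mul {m : ℕ} (T : H →L[ℂ] H)
    (Y : PiLp 2 (fun _ : Fin m => H) →L[ℂ] PiLp 2 (fun _ : Fin m => H)) :
    blockAverage m (ampliation m T * Y) = T * blockAverage m Y := by
  ext x
  simp [blockAverage_apply, mul_apply_eq_comp, ampliation_apply]

theorem blockAverage_mul_ampliation {m : ℕ} (T : H →L[ℂ] H)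
    (Y : PiLp 2 (fun _ : Fin m => H) →L[ℂ] PiLp 2 (fun _ : Fin m => H)) :
    blockAverage m (Y * ampliation m T) = blockAverage m Y * T := by
  ext x
  simp only [blockAverage_apply, mul_apply_eq_comp, ampliation_single]

theorem blockAverage_one {m : ℕ} (hm : 1 ≤ m) :
    blockAverage (H := H) m 1 = 1 := by
  ext x
  have : (m : ℝ) ≠ 0 := by positivity
  simp only [blockAverage_apply, one_apply_eq_self, PiLp.single_eq_same, Finset.sum_const,
    Finset.card_univ, Fintype.card_fin]
  rw [← Nat.cast_smul_eq_nsmul ℝ, inv_smul_smul₀ this]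

theorem blockAverage_ampliation {m : ℕ} (hm : 1 ≤ m) (T : H →L[ℂ] H) :
    blockAverage m (ampliation m T) = T := by
  rw [← mul_one (ampliation m T), blockAverage_ampliation_mul, blockAverage_one hm, mul_one]

theorem blockAverage_nonneg {m : ℕ}
    {Y : PiLp 2 (fun _ : Fin m => H) →L[ℂ] PiLp 2 (fun _ : Fin m => H)} (hY : 0 ≤ Y) :
    0 ≤ blockAverage m Y := by
  rw [ContinuousLinearMap.nonneg_iff_isPositive] at hY ⊢
  have h := (ContinuousLinearMap.isPositive_sum Finset.univ fun i (_ : i ∈ Finset.univ) =>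
    hY.conj_adjoint (PiLp.proj 2 (fun _ : Fin m => H) i : _ →L[ℂ] H))
  have h2 := h.smul_of_nonneg (c := (((m : ℝ)⁻¹ : ℝ) : ℂ)) (by
    rw [Complex.zero_le_real]; positivity)
  rwa [Complex.coe_smul] at h2

theorem blockAverage_mono {m : ℕ}
    {Y Z : PiLp 2 (fun _ : Fin m => H) →L[ℂ] PiLp 2 (fun _ : Fin m => H)} (h : Y ≤ Z) :
    blockAverage m Y ≤ blockAverage m Z := by
  rw [← sub_nonneg, ← blockAverage_sub]
  exact blockAverage_nonneg (sub_nonneg.mpr h)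

theorem IsFiniteRank.blockAverage {m : ℕ}
    {Y : PiLp 2 (fun _ : Fin m => H) →L[ℂ] PiLp 2 (fun _ : Fin m => H)} (hY : IsFiniteRank Y) :
    IsFiniteRank (blockAverage m Y) := by
  have : FiniteDimensional ℂ (LinearMap.range
    (Y : PiLp 2 (fun _ : Fin m => H) →ₗ[ℂ] PiLp 2 (fun _ : Fin m => H))) := hY
  refine Submodule.finiteDimensional_of_le (S₂ := ⨆ i : Fin m,
    (LinearMap.range (Y : PiLp 2 (fun _ : Fin m => H) →ₗ[ℂ] PiLp 2 (fun _ : Fin m => H))).map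
      ((PiLp.proj 2 (fun _ : Fin m => H) i : _ →L[ℂ] H) : _ →ₗ[ℂ] H)) ?_
  rintro _ ⟨x, rfl⟩
  have h : (QuasicentralModulus.blockAverage m Y : H →ₗ[ℂ] H) x =
      (((m : ℝ)⁻¹ : ℝ) : ℂ) • ∑ i : Fin m, (Y (PiLp.single 2 i x)) i := by
    rw [Complex.coe_smul]; exact blockAverage_apply Y x
  rw [h]
  exact Submodule.smul_mem _ _ (Submodule.sum_mem _ fun i _ =>
    Submodule.mem_iSup_of_mem i ⟨_, ⟨PiLp.single 2 i x, rfl⟩, rfl⟩)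

theorem ampliation_mono (m : ℕ) {S T : H →L[ℂ] H} (h : S ≤ T) :
    ampliation m S ≤ ampliation m T := by
  rw [← sub_nonneg, ← ampliation_sub]
  exact ampliation_nonneg m (sub_nonneg.mpr h)

/-- Each singular pair of the average is copied into all `m` summands. One placement sees the
diagonal blocks with unequal weights, so all `m` cyclic shifts are summed: every index then meets
every block once, and some shift does at least as well as the mean. -/
theorem rpow_mul_lorentzNorm_blockAverage_le {p : ℝ≥0∞} (hp : 1 ≤ p) {m : ℕ} (hm : 1 ≤ m)
    {Y : PiLp 2 (fun _ : Fin m => H) →L[ℂ] PiLp 2 (fun _ : Fin m => H)} (hY : IsFiniteRank Y) :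
    (m : ℝ≥0∞) ^ (p⁻¹).toReal * lorentzNorm p (blockAverage m Y) ≤ lorentzNorm p Y := by
  have : NeZero m := ⟨by omega⟩
  have hm0 : (0 : ℝ) < m := by exact_mod_cast hm
  obtain ⟨r, s, e, f, h⟩ := exists_isSVD _ hY.blockAverage
  have hsum0 : 0 ≤ ∑ j ∈ Finset.range r, weight p j * s j :=
    Finset.sum_nonneg fun j _ => mul_nonneg (weight_nonneg p j) (h.nonneg j)
  rw [lorentzNorm_eq_of_isSVD p hY.blockAverage h le_rfl, ← ENNReal.ofReal_natCast m,
    ENNReal.ofReal_rpow_of_pos hm0, ← ENNReal.ofReal_mul (by positivity)]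
  let E : (Fin r → H) → Fin m → Fin (r * m) → PiLp 2 (fun _ : Fin m => H) := fun g c k =>
    PiLp.single 2 ((finProdFinEquiv.symm k).2 + c) (g (finProdFinEquiv.symm k).1)
  have hE : ∀ g, Orthonormal ℂ g → ∀ c, Orthonormal ℂ (E g c) :=
    fun g hg c => orthonormal_shifted_single hg c
  have hblock : ∀ j : Fin r, ∑ i : Fin m, ⟪f j, (Y (PiLp.single 2 i (e j))) i⟫_ℂ = m * s j := by
    intro j
    have h1 := h.inner_apply j
    rw [blockAverage_apply, ← Complex.coe_smul, inner_smul_right, inner_sum] at h1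
    rw [← h1]
    have : (m : ℂ) ≠ 0 := by exact_mod_cast hm0.ne'
    push_cast
    rw [mul_inv_cancel_left₀ this]
  have hshift : ∀ k : Fin (r * m), (m : ℝ) * s (finProdFinEquiv.symm k).1 ≤
      ∑ c : Fin m, ‖⟪E f c k, Y (E e c k)⟫_ℂ‖ := by
    intro k
    have h1 : ∑ c : Fin m, ⟪E f c k, Y (E e c k)⟫_ℂ = m * s (finProdFinEquiv.symm k).1 := by
      rw [← hblock, ← Equiv.sum_comp (Equiv.addLeft (finProdFinEquiv.symm k).2)
        (fun i => ⟪f (finProdFinEquiv.symm k).1,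
          (Y (PiLp.single 2 i (e (finProdFinEquiv.symm k).1))) i⟫_ℂ)]
      exact Finset.sum_congr rfl fun c _ => inner_single_left _ _ _
    refine le_trans (le_of_eq ?_) (norm_sum_le _ _)
    rw [h1, norm_mul, Complex.norm_natCast, Complex.norm_real, Real.norm_eq_abs,
      abs_of_nonneg (h.nonneg _)]
  have htotal : ∑ _c : Fin m, (m : ℝ) ^ (p⁻¹).toReal * ∑ j ∈ Finset.range r, weight p j * s j ≤
      ∑ c : Fin m, ∑ k : Fin (r * m), weight p k * ‖⟪E f c k, Y (E e c k)⟫_ℂ‖ := by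
    rw [Finset.sum_const, Finset.card_univ, Fintype.card_fin, nsmul_eq_mul]
    calc (m : ℝ) * ((m : ℝ) ^ (p⁻¹).toReal * ∑ j ∈ Finset.range r, weight p j * s j)
        ≤ m * ∑ j : Fin r, (∑ i : Fin m, weight p (i + m * j)) * s j := by
          refine mul_le_mul_of_nonneg_left ?_ hm0.le
          rw [← Fin.sum_univ_eq_sum_range (fun j => weight p j * s j), Finset.mul_sum]
          refine Finset.sum_le_sum fun j _ => ?_
          rw [← mul_assoc]
          exact mul_le_mul_of_nonneg_right (rpow_mul_weight_le_sum hp hm j) (h.nonneg j)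
      _ = ∑ k : Fin (r * m), weight p k * (m * s (finProdFinEquiv.symm k).1) := by
          rw [sum_finProdFinEquiv, Finset.mul_sum]
          refine Finset.sum_congr rfl fun j _ => ?_
          rw [Finset.sum_mul, Finset.mul_sum]
          refine Finset.sum_congr rfl fun i _ => ?_
          rw [Equiv.symm_apply_apply, finProdFinEquiv_apply_val]
          ring
      _ ≤ ∑ k : Fin (r * m), ∑ c : Fin m, weight p k * ‖⟪E f c k, Y (E e c k)⟫_ℂ‖ :=
          Finset.sum_le_sum fun k _ => by
            rw [← Finset.mul_sum]
            exact mul_le_mul_of_nonneg_left (hshift k) (weight_nonneg p k)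
      _ = _ := Finset.sum_comm
  obtain ⟨c, -, hc⟩ := Finset.exists_le_of_sum_le ⟨0, Finset.mem_univ _⟩ htotal
  exact (ENNReal.ofReal_le_ofReal hc).trans
    (sum_weight_mul_norm_inner_le_lorentzNorm hp hY (hE e h.left c) (hE f h.right c))

/-! ### The directed set of finite rank positive contractions. -/

theorem eq_zero_of_nonneg_of_inner_eq_zero {B : H →L[ℂ] H} (hB : 0 ≤ B) {x : H}
    (hx : ⟪B x, x⟫_ℂ = 0) : B x = 0 := by
  have h1 : CFC.sqrt B * CFC.sqrt B = B := CFC.sqrt_mul_sqrt_self B hB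
  have h2 := ((ContinuousLinearMap.nonneg_iff_isPositive _).mp (CFC.sqrt_nonneg B)).isSymmetric
  rw [← h1] at hx
  have h3 : ⟪CFC.sqrt B x, CFC.sqrt B x⟫_ℂ = 0 := (h2 (CFC.sqrt B x) x).symm.trans hx
  rw [← h1, mul_apply_eq_comp, inner_self_eq_zero.mp h3, map_zero]

open scoped ComplexOrder in
-- For `x` in `V` the nonnegative forms of `A - P` and `1 - A` at `x` are negatives of each other,
-- so both vanish.
theorem apply_eq_self_of_starProjection_le {V : Submodule ℂ H} [V.HasOrthogonalProjection]
    {A : H →L[ℂ] H} (hVA : V.starProjection ≤ A) (hA : A ≤ 1) {x : H} (hx : x ∈ V) : A x = x := by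
  have h1 : (A - V.starProjection).IsPositive := hVA
  have h2 : (1 - A).IsPositive := hA
  have hPx : V.starProjection x = x := Submodule.starProjection_eq_self_iff.mpr hx
  have h3 := h1.inner_nonneg_left x
  have h4 := h2.inner_nonneg_left x
  have h5 : ⟪(A - V.starProjection) x, x⟫_ℂ = -⟪(1 - A) x, x⟫_ℂ := by
    rw [← inner_neg_left]; congr 1; simp [hPx]
  rw [h5] at h3
  have h6 := eq_zero_of_nonneg_of_inner_eq_zero
    ((ContinuousLinearMap.nonneg_iff_isPositive _).mpr h2)
    (le_antisymm (neg_nonneg.mp h3) h4)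
  rw [sub_apply, one_apply_eq_self, sub_eq_zero] at h6
  exact h6.symm

/-- Since `P A = A = A P`, the difference `P - A` equals `P (1 - A) P`. -/
theorem le_of_isStarProjection {P A : H →L[ℂ] H} (hP : IsStarProjection P) (hA0 : 0 ≤ A)
    (hA1 : A ≤ 1) (h : P * A = A) : A ≤ P := by
  have h2 : A * P = A := by
    have := congrArg star h
    rwa [star_mul, (IsSelfAdjoint.of_nonneg hA0).star_eq, hP.isSelfAdjoint.star_eq] at this
  have h3 : P - A = P ∘L (1 - A) ∘L P† := by
    have h4 : P * P = P := hP.isIdempotentElem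
    have h5 : P† = P := hP.isSelfAdjoint.star_eq
    have : P * ((1 - A) * P) = P - A := by rw [sub_mul, one_mul, h2, mul_sub, h4, h]
    rw [h5]
    exact this.symm
  rw [ContinuousLinearMap.le_def, h3]
  exact ContinuousLinearMap.IsPositive.conj_adjoint hA1 P

theorem le_starProjection {V : Submodule ℂ H} [V.HasOrthogonalProjection] {A : H →L[ℂ] H}
    (hA0 : 0 ≤ A) (hA1 : A ≤ 1) (hV : ∀ x, A x ∈ V) : A ≤ V.starProjection :=
  le_of_isStarProjection isStarProjection_starProjection hA0 hA1
    (by ext x; exact Submodule.starProjection_eq_self_iff.mpr (hV x))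

/-- The orthogonal projection onto a finite dimensional subspace. -/
def projectionContraction (V : Submodule ℂ H) [FiniteDimensional ℂ V] :
    FiniteRankPosContraction H :=
  ⟨V.starProjection, by
    refine Submodule.finiteDimensional_of_le (S₂ := V) ?_
    rintro _ ⟨x, rfl⟩
    exact Submodule.starProjection_apply_mem V x,
    (isStarProjection_starProjection (U := V)).nonneg,
    (isStarProjection_starProjection (U := V)).le_one⟩

theorem le_projectionContraction (A : FiniteRankPosContraction H) {V : Submodule ℂ H}
    [FiniteDimensional ℂ V] (hV : ∀ x, A.1 x ∈ V) : A ≤ projectionContraction V :=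
  le_starProjection A.2.2.1 A.2.2.2 hV

instance : IsDirectedOrder (FiniteRankPosContraction H) where
  directed A B := by
    have := A.2.1
    have := B.2.1
    exact ⟨projectionContraction (LinearMap.range (A.1 : H →ₗ[ℂ] H) ⊔
        LinearMap.range (B.1 : H →ₗ[ℂ] H)),
      le_projectionContraction A fun x => Submodule.mem_sup_left ⟨x, rfl⟩,
      le_projectionContraction B fun x => Submodule.mem_sup_right ⟨x, rfl⟩⟩

instance : Nonempty (FiniteRankPosContraction H) :=
  ⟨projectionContraction ⊥⟩

/-! ### Making commutators small in operator norm. -/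

/-- `X` acts within `V` and `Y` within its orthogonal complement, so Pythagoras applies to both
arguments and values. -/
theorem norm_add_le_of_orthogonal {X Y : H →L[ℂ] H} {V : Submodule ℂ H}
    [V.HasOrthogonalProjection] (hX : ∀ x, X x ∈ V) (hX' : ∀ x, (X†) x ∈ V)
    (hY : ∀ x ∈ V, Y x = 0) (hY' : ∀ x ∈ V, (Y†) x = 0) {C : ℝ} (hXC : ‖X‖ ≤ C) (hYC : ‖Y‖ ≤ C) :
    ‖X + Y‖ ≤ C := by
  have hC : 0 ≤ C := (norm_nonneg _).trans hXC
  refine ContinuousLinearMap.opNorm_le_bound _ hC fun x => ?_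
  set u := V.starProjection x with hu
  have huV : u ∈ V := Submodule.starProjection_apply_mem V x
  have hq : x - u ∈ Vᗮ := Submodule.sub_starProjection_mem_orthogonal x
  have hXx : X x = X u := by
    have h1 : X (x - u) = 0 := by
      rw [← inner_self_eq_zero (𝕜 := ℂ), ← ContinuousLinearMap.adjoint_inner_left]
      exact Submodule.inner_right_of_mem_orthogonal (hX' _) hq
    rwa [map_sub, sub_eq_zero] at h1
  have hYx : Y x = Y (x - u) := by rw [map_sub, hY u huV, sub_zero]
  have horth : ⟪X x, Y x⟫_ℂ = 0 := by
    rw [← ContinuousLinearMap.adjoint_inner_left, hY' _ (hX x), inner_zero_left]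
  have h1 := norm_add_sq_eq_norm_sq_add_norm_sq_of_inner_eq_zero (X x) (Y x) horth
  have h2 := norm_add_sq_eq_norm_sq_add_norm_sq_of_inner_eq_zero u (x - u)
    (Submodule.inner_right_of_mem_orthogonal huV hq)
  rw [add_sub_cancel] at h2
  have h3 : ‖X x‖ ≤ C * ‖u‖ := hXx ▸ X.le_of_opNorm_le hXC u
  have h4 : ‖Y x‖ ≤ C * ‖x - u‖ := hYx ▸ Y.le_of_opNorm_le hYC (x - u)
  have h5 : ‖X x‖ * ‖X x‖ ≤ (C * ‖u‖) * (C * ‖u‖) := by gcongr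
  have h6 : ‖Y x‖ * ‖Y x‖ ≤ (C * ‖x - u‖) * (C * ‖x - u‖) := by gcongr
  refine abs_le_of_sq_le_sq' ?_ (by positivity) |>.2
  rw [add_apply]
  calc ‖X x + Y x‖ ^ 2 ≤ C * ‖u‖ * (C * ‖u‖) + C * ‖x - u‖ * (C * ‖x - u‖) := by
        rw [sq, h1]; exact add_le_add h5 h6
    _ = C ^ 2 * (‖u‖ * ‖u‖ + ‖x - u‖ * ‖x - u‖) := by ring
    _ = (C * ‖x‖) ^ 2 := by rw [← h2]; ring

/-- `V + ∑ i, T_i V + ∑ i, T_i* V`. -/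
def enlarge {n : ℕ} (τ : Fin n → H →L[ℂ] H) (V : Submodule ℂ H) : Submodule ℂ H :=
  V ⊔ ((⨆ i, V.map (τ i : H →ₗ[ℂ] H)) ⊔ ⨆ i, V.map ((τ i)† : H →ₗ[ℂ] H))

instance {n : ℕ} (τ : Fin n → H →L[ℂ] H) (V : Submodule ℂ H) [FiniteDimensional ℂ V] :
    FiniteDimensional ℂ (enlarge τ V) := by
  unfold enlarge; infer_instance

theorem le_enlarge {n : ℕ} (τ : Fin n → H →L[ℂ] H) (V : Submodule ℂ H) : V ≤ enlarge τ V :=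
  le_sup_left

theorem apply_mem_enlarge {n : ℕ} (τ : Fin n → H →L[ℂ] H) {V : Submodule ℂ H} {x : H}
    (hx : x ∈ V) (i : Fin n) : τ i x ∈ enlarge τ V :=
  Submodule.mem_sup_right (Submodule.mem_sup_left (Submodule.mem_iSup_of_mem i ⟨x, hx, rfl⟩))

theorem adjoint_apply_mem_enlarge {n : ℕ} (τ : Fin n → H →L[ℂ] H) {V : Submodule ℂ H} {x : H}
    (hx : x ∈ V) (i : Fin n) : ((τ i)†) x ∈ enlarge τ V :=
  Submodule.mem_sup_right (Submodule.mem_sup_right (Submodule.mem_iSup_of_mem i ⟨x, hx, rfl⟩))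

theorem adjoint_commutator_apply {A : H →L[ℂ] H} (hA : IsSelfAdjoint A) (T : H →L[ℂ] H) (x : H) :
    ((T * A - A * T)†) x = A ((T†) x) - (T†) (A x) := by
  have h : (T * A - A * T)† = A * (T†) - (T†) * A := by
    have h' := hA.star_eq
    have : star (T * A - A * T) = A * star T - star T * A := by
      rw [star_sub, star_mul, star_mul, h']
    exact this
  rw [h]; rfl

theorem norm_commutator_le {A : H →L[ℂ] H} (hA0 : 0 ≤ A) (hA1 : A ≤ 1) (T : H →L[ℂ] H) :
    ‖T * A - A * T‖ ≤ 2 * ‖T‖ := by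
  have hA : ‖A‖ ≤ 1 := (CStarAlgebra.norm_le_one_iff_of_nonneg A hA0).mpr hA1
  have h1 := (norm_mul_le T A).trans (mul_le_of_le_one_right (norm_nonneg _) hA)
  have h2 := (norm_mul_le A T).trans (mul_le_of_le_one_left (norm_nonneg _) hA)
  linarith [norm_sub_le (T * A) (A * T)]

theorem isFiniteRank_zero : IsFiniteRank (0 : H →L[ℂ] H) :=
  IsFiniteRank.of_range_le (T := (projectionContraction (⊥ : Submodule ℂ H)).1)
    (projectionContraction (⊥ : Submodule ℂ H)).2.1 (by rintro _ ⟨x, rfl⟩; exact ⟨0, by simp⟩)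

theorem lorentzNorm_zero {p : ℝ≥0∞} (hp : 1 ≤ p) : lorentzNorm p (0 : H →L[ℂ] H) = 0 := by
  simpa using lorentzNorm_smul_le hp (isFiniteRank_zero (H := H)) le_rfl

/-- Sums of finite rank contractions, each acting as the identity on a large subspace determined
by the previous ones: the commutators have orthogonal supports, so that the operator norm of their
sum stays bounded. -/
theorem exists_sum_of_cofinal {p : ℝ≥0∞} (hp : 1 ≤ p) {n : ℕ} (τ : Fin n → H →L[ℂ] H) {L : ℝ≥0∞}
    (hL : ∀ A₁ : FiniteRankPosContraction H, ∃ A, A₁ ≤ A ∧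
      ∀ i, lorentzNorm p (τ i * A.1 - A.1 * τ i) ≤ L) (A₀ : FiniteRankPosContraction H) (M : ℕ) :
    ∃ S : H →L[ℂ] H, IsFiniteRank S ∧ M • A₀.1 ≤ S ∧ S ≤ M • (1 : H →L[ℂ] H) ∧
      (∀ i, lorentzNorm p (τ i * S - S * τ i) ≤ M * L) ∧
      ∀ i, ‖τ i * S - S * τ i‖ ≤ 2 * ‖τ i‖ := by
  induction M with
  | zero =>
    refine ⟨0, isFiniteRank_zero, by simp, by simp, fun i => ?_, fun i => ?_⟩
    · simp [lorentzNorm_zero hp]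
    · simp
  | succ M ih =>
    obtain ⟨S, hSf, hS0, hS1, hSL, hSn⟩ := ih
    have hSsa : IsSelfAdjoint S := IsSelfAdjoint.of_nonneg ((nsmul_nonneg A₀.2.2.1 M).trans hS0)
    have := A₀.2.1
    have : FiniteDimensional ℂ (LinearMap.range (S : H →ₗ[ℂ] H)) := hSf
    -- One enlargement of the range of `S` contains the ranges of the commutators with `S` and of
    -- their adjoints.
    let V := enlarge τ (LinearMap.range (S : H →ₗ[ℂ] H))
    have hSV : ∀ x, S x ∈ V := fun x => le_enlarge τ _ ⟨x, rfl⟩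
    -- The second enlargement makes `A` fix `V`, `τ i V` and `(τ i)* V`, so its commutators and
    -- their adjoints vanish on `V`; the range of `A₀` is added to force `A₀ ≤ A`.
    let W := enlarge τ V ⊔ LinearMap.range (A₀.1 : H →ₗ[ℂ] H)
    obtain ⟨A, hA, hAL⟩ := hL (projectionContraction W)
    have hA₀ : A₀ ≤ A :=
      (le_projectionContraction A₀ fun x =>
        Submodule.mem_sup_right (LinearMap.mem_range_self (A₀.1 : H →ₗ[ℂ] H) x)).trans hA
    have hAW : ∀ x ∈ enlarge τ V, A.1 x = x := fun x hx =>
      apply_eq_self_of_starProjection_le (V := W) hA A.2.2.2 (Submodule.mem_sup_left hx)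
    have hAV : ∀ x ∈ V, A.1 x = x := fun x hx => hAW x (le_enlarge τ V hx)
    have hAsa : IsSelfAdjoint A.1 := IsSelfAdjoint.of_nonneg A.2.2.1
    have hsplit : ∀ i, τ i * (S + A.1) - (S + A.1) * τ i =
        (τ i * S - S * τ i) + (τ i * A.1 - A.1 * τ i) := fun i => by noncomm_ring
    refine ⟨S + A.1, hSf.add A.2.1, ?_, ?_, fun i => ?_, fun i => ?_⟩
    · rw [succ_nsmul]; exact add_le_add hS0 hA₀
    · rw [succ_nsmul]; exact add_le_add hS1 A.2.2.2
    · rw [hsplit]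
      refine (lorentzNorm_add_le hp (hSf.commutator _) (IsFiniteRank.commutator A.2.1 _)).trans ?_
      rw [Nat.cast_succ, add_mul, one_mul]
      exact add_le_add (hSL i) (hAL i)
    · rw [hsplit]
      refine norm_add_le_of_orthogonal (V := V) (fun x => ?_) (fun x => ?_) (fun x hx => ?_)
        (fun x hx => ?_) (hSn i) (norm_commutator_le A.2.2.1 A.2.2.2 _)
      · exact V.sub_mem (apply_mem_enlarge τ (LinearMap.mem_range_self (S : H →ₗ[ℂ] H) x) i) (hSV _)
      · rw [adjoint_commutator_apply hSsa]
        exact V.sub_mem (hSV _)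
          (adjoint_apply_mem_enlarge τ (LinearMap.mem_range_self (S : H →ₗ[ℂ] H) x) i)
      · rw [sub_apply, mul_apply_eq_comp, mul_apply_eq_comp, hAV x hx,
          hAW _ (apply_mem_enlarge τ hx i), sub_self]
      · rw [adjoint_commutator_apply hAsa, hAV x hx, hAW _ (adjoint_apply_mem_enlarge τ hx i),
          sub_self]

theorem exists_norm_commutator_le {p : ℝ≥0∞} (hp : 1 ≤ p) {n : ℕ} (τ : Fin n → H →L[ℂ] H)
    {L : ℝ≥0∞} (hL : ∀ A₁ : FiniteRankPosContraction H, ∃ A, A₁ ≤ A ∧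
      ∀ i, lorentzNorm p (τ i * A.1 - A.1 * τ i) ≤ L) (A₀ : FiniteRankPosContraction H) {M : ℕ}
    (hM : 1 ≤ M) :
    ∃ A, A₀ ≤ A ∧ (∀ i, lorentzNorm p (τ i * A.1 - A.1 * τ i) ≤ L) ∧
      ∀ i, ‖τ i * A.1 - A.1 * τ i‖ ≤ (M : ℝ)⁻¹ * (2 * ‖τ i‖) := by
  obtain ⟨S, hSf, hS0, hS1, hSL, hSn⟩ := exists_sum_of_cofinal hp τ hL A₀ M
  have hM0 : (M : ℝ) ≠ 0 := by positivity
  have hMi : (0 : ℝ) ≤ (M : ℝ)⁻¹ := by positivity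
  have hcancel : ∀ T : H →L[ℂ] H, (M : ℝ)⁻¹ • (M • T) = T := fun T => by
    rw [← Nat.cast_smul_eq_nsmul ℝ, inv_smul_smul₀ hM0]
  have h0 : A₀.1 ≤ (M : ℝ)⁻¹ • S := by
    have := smul_le_smul_of_nonneg_left hS0 hMi
    rwa [hcancel] at this
  have h1 : (M : ℝ)⁻¹ • S ≤ 1 := by
    have := smul_le_smul_of_nonneg_left hS1 hMi
    rwa [hcancel] at this
  have hc : ∀ i, τ i * ((M : ℝ)⁻¹ • S) - ((M : ℝ)⁻¹ • S) * τ i =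
      (M : ℝ)⁻¹ • (τ i * S - S * τ i) := fun i => by
    rw [mul_smul_comm, smul_mul_assoc, smul_sub]
  refine ⟨⟨(M : ℝ)⁻¹ • S, hSf.smul _, A₀.2.2.1.trans h0, h1⟩, h0, fun i => ?_, fun i => ?_⟩
  · rw [hc]
    refine (lorentzNorm_smul_le hp (hSf.commutator _) hMi).trans ?_
    refine (mul_le_mul_right (hSL i) _).trans (le_of_eq ?_)
    have hpos : (0 : ℝ) < M := by positivity
    rw [← mul_assoc, ENNReal.ofReal_inv_of_pos hpos, ENNReal.ofReal_natCast,
      ENNReal.inv_mul_cancel (by exact_mod_cast (by omega : M ≠ 0)) (ENNReal.natCast_ne_top M),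
      one_mul]
  · rw [hc, norm_smul, Real.norm_of_nonneg hMi]
    exact mul_le_mul_of_nonneg_left (hSn i) hMi

/-! ### The two inequalities for the modulus. -/

theorem quasicentralModulus_eq {n : ℕ} (N : (H →L[ℂ] H) → ℝ≥0∞) (τ : Fin n → H →L[ℂ] H) :
    quasicentralModulus N τ = ⨆ A₀ : FiniteRankPosContraction H,
      ⨅ A : FiniteRankPosContraction H, ⨅ _ : A₀ ≤ A, tupleNorm N (tupleCommutator τ A.1) := by
  rw [quasicentralModulus, Filter.atTop_basis.liminf_eq_iSup_iInf]
  simp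

theorem lorentzNorm_commutator_le_tupleNorm (p : ℝ≥0∞) {n : ℕ} (τ : Fin n → H →L[ℂ] H)
    (A : H →L[ℂ] H) (i : Fin n) :
    lorentzNorm p (τ i * A - A * τ i) ≤ tupleNorm (lorentzNorm p) (tupleCommutator τ A) :=
  le_iSup (fun i => lorentzNorm p (tupleCommutator τ A i)) i

/-- The ampliation of a finite rank positive contraction. -/
def ampliationContraction {m : ℕ} (hm : 1 ≤ m) (A : FiniteRankPosContraction H) :
    FiniteRankPosContraction (PiLp 2 (fun _ : Fin m => H)) :=
  ⟨ampliation m A.1, IsFiniteRank.ampliation A.2.1 hm, ampliation_nonneg m A.2.2.1,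
    (ampliation_mono m A.2.2.2).trans (ampliation_one m).le⟩

/-- The averaged diagonal block of a finite rank positive contraction. -/
def blockAverageContraction {m : ℕ} (hm : 1 ≤ m)
    (B : FiniteRankPosContraction (PiLp 2 (fun _ : Fin m => H))) : FiniteRankPosContraction H :=
  ⟨blockAverage m B.1, IsFiniteRank.blockAverage B.2.1, blockAverage_nonneg B.2.2.1,
    (blockAverage_mono B.2.2.2).trans (blockAverage_one hm).le⟩

/-- Ampliations are cofinal: project onto the span of all coordinates of vectors in the range of
`B`. -/
theorem exists_le_ampliationContraction {m : ℕ} (hm : 1 ≤ m)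
    (B : FiniteRankPosContraction (PiLp 2 (fun _ : Fin m => H))) :
    ∃ A : FiniteRankPosContraction H, B ≤ ampliationContraction hm A := by
  have := B.2.1
  let V : Submodule ℂ H := ⨆ i : Fin m,
    (LinearMap.range (B.1 : PiLp 2 (fun _ : Fin m => H) →ₗ[ℂ] PiLp 2 (fun _ : Fin m => H))).map
      ((PiLp.proj 2 (fun _ : Fin m => H) i : PiLp 2 (fun _ : Fin m => H) →L[ℂ] H) :
        PiLp 2 (fun _ : Fin m => H) →ₗ[ℂ] H)
  refine ⟨projectionContraction V, ?_⟩
  refine le_of_isStarProjection (P := ampliation m (projectionContraction V).1) ⟨?_, ?_⟩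
    B.2.2.1 B.2.2.2 ?_
  · rw [IsIdempotentElem, ← ampliation_mul]
    congr 1
    exact (isStarProjection_starProjection (U := V)).isIdempotentElem
  · exact IsSelfAdjoint.of_nonneg (ampliation_nonneg m (projectionContraction V).2.2.1)
  · ext x i
    rw [mul_apply_eq_comp, ampliation_apply]
    exact Submodule.starProjection_eq_self_iff.mpr
      (Submodule.mem_iSup_of_mem i ⟨_, ⟨x, rfl⟩, rfl⟩)

theorem rpow_mul_kMinus_le {p : ℝ≥0∞} (hp : 1 ≤ p) {n : ℕ} (τ : Fin n → H →L[ℂ] H) {m : ℕ}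
    (hm : 1 ≤ m) :
    (m : ℝ≥0∞) ^ (p⁻¹).toReal * kMinus p τ ≤ kMinus p (fun i => ampliation m (τ i)) := by
  rw [kMinus, kMinus, quasicentralModulus_eq, quasicentralModulus_eq, ENNReal.mul_iSup]
  refine iSup_le fun A₀ => le_iSup_of_le (ampliationContraction hm A₀) (le_iInf₂ fun B hB => ?_)
  have hA : A₀ ≤ blockAverageContraction hm B := by
    have := blockAverage_mono (show ampliation m A₀.1 ≤ B.1 from hB)
    rwa [blockAverage_ampliation hm] at this
  refine (mul_le_mul_right (iInf₂_le (blockAverageContraction hm B) hA) _).trans ?_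
  rw [tupleNorm, ENNReal.mul_iSup]
  refine iSup_le fun i => ?_
  refine le_trans ?_ (lorentzNorm_commutator_le_tupleNorm p (fun i => ampliation m (τ i)) B.1 i)
  refine le_trans (le_of_eq ?_)
    (rpow_mul_lorentzNorm_blockAverage_le hp hm (IsFiniteRank.commutator B.2.1 _))
  rw [blockAverage_sub, blockAverage_ampliation_mul, blockAverage_mul_ampliation]
  rfl

theorem tupleNorm_ampliation_le {p : ℝ≥0∞} (hp : 1 ≤ p) {n : ℕ} (τ : Fin n → H →L[ℂ] H) {m : ℕ}
    (hm : 1 ≤ m) {M : ℕ} (hM : 1 ≤ M) {A : H →L[ℂ] H} (hA : IsFiniteRank A) {L : ℝ≥0∞} {C : ℝ}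
    (hL : ∀ i, lorentzNorm p (τ i * A - A * τ i) ≤ L)
    (hC : ∀ i, ‖τ i * A - A * τ i‖ ≤ C) :
    tupleNorm (lorentzNorm p) (tupleCommutator (fun i => ampliation m (τ i)) (ampliation m A)) ≤
      ENNReal.ofReal (m * M * C) +
        ENNReal.ofReal (1 + (M : ℝ)⁻¹) * ((m : ℝ≥0∞) ^ (p⁻¹).toReal * L) := by
  refine iSup_le fun i => ?_
  have h : tupleCommutator (fun i => ampliation m (τ i)) (ampliation m A) i =
      ampliation m (τ i * A - A * τ i) := rfl
  rw [h]
  refine (lorentzNorm_ampliation_le hp (hA.commutator _) hm hM).trans ?_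
  gcongr
  · exact hC i
  · exact hL i

open Filter Topology in
theorem kMinus_ampliation_le {p : ℝ≥0∞} (hp : 1 ≤ p) {n : ℕ} (τ : Fin n → H →L[ℂ] H) {m : ℕ}
    (hm : 1 ≤ m) :
    kMinus p (fun i => ampliation m (τ i)) ≤ (m : ℝ≥0∞) ^ (p⁻¹).toReal * kMinus p τ := by
  have hmpow : (m : ℝ≥0∞) ^ (p⁻¹).toReal ≠ ∞ :=
    ENNReal.rpow_ne_top_of_nonneg ENNReal.toReal_nonneg (ENNReal.natCast_ne_top m)
  have hmain : ∀ L, kMinus p τ < L →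
      kMinus p (fun i => ampliation m (τ i)) ≤ (m : ℝ≥0∞) ^ (p⁻¹).toReal * L := by
    intro L hL
    have hcof : ∀ A₁ : FiniteRankPosContraction H, ∃ A, A₁ ≤ A ∧
        ∀ i, lorentzNorm p (τ i * A.1 - A.1 * τ i) ≤ L := by
      intro A₁
      rw [kMinus, quasicentralModulus_eq] at hL
      have h1 := (le_iSup (fun A₀ : FiniteRankPosContraction H =>
        ⨅ A : FiniteRankPosContraction H, ⨅ _ : A₀ ≤ A,
          tupleNorm (lorentzNorm p) (tupleCommutator τ A.1)) A₁).trans_lt hL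
      simp only [iInf_lt_iff] at h1
      obtain ⟨A, hA, hlt⟩ := h1
      exact ⟨A, hA, fun i => (lorentzNorm_commutator_le_tupleNorm p τ A.1 i).trans hlt.le⟩
    rw [kMinus, quasicentralModulus_eq]
    refine iSup_le fun B₀ => ?_
    obtain ⟨A₀, hBA⟩ := exists_le_ampliationContraction hm B₀
    let c : ℝ := ∑ i, 2 * ‖τ i‖
    have hbound : ∀ M : ℕ, 1 ≤ M →
        (⨅ B : FiniteRankPosContraction (PiLp 2 (fun _ : Fin m => H)), ⨅ _ : B₀ ≤ B,
          tupleNorm (lorentzNorm p) (tupleCommutator (fun i => ampliation m (τ i)) B.1)) ≤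
        ENNReal.ofReal (m * c * (M : ℝ)⁻¹) +
          ENNReal.ofReal (1 + (M : ℝ)⁻¹) * ((m : ℝ≥0∞) ^ (p⁻¹).toReal * L) := by
      intro M hM
      -- Averaging `M * M` operators turns the head error `m * M * ‖X‖` into one of order `1 / M`.
      obtain ⟨A, hA, hAL, hAn⟩ := exists_norm_commutator_le hp τ hcof A₀ (M := M * M)
        (Nat.mul_pos hM hM)
      have hle : B₀ ≤ ampliationContraction hm A := hBA.trans (ampliation_mono m hA)
      refine (iInf₂_le _ hle).trans ((tupleNorm_ampliation_le hp τ hm hM A.2.1 hAL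
        (C := ((M * M : ℕ) : ℝ)⁻¹ * c) fun i => (hAn i).trans ?_).trans (le_of_eq ?_))
      · refine mul_le_mul_of_nonneg_left ?_ (by positivity)
        exact Finset.single_le_sum (f := fun i => 2 * ‖τ i‖) (fun i _ => by positivity)
          (Finset.mem_univ i)
      · have : (M : ℝ) ≠ 0 := by positivity
        congr 2
        push_cast
        field_simp
    have hinv : Tendsto (fun M : ℕ => (M : ℝ)⁻¹) atTop (𝓝 0) :=
      tendsto_inv_atTop_zero.comp tendsto_natCast_atTop_atTop
    have h1 : Tendsto (fun M : ℕ => ENNReal.ofReal (m * c * (M : ℝ)⁻¹)) atTop (𝓝 0) := by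
      simpa using ENNReal.tendsto_ofReal (hinv.const_mul (m * c))
    have h2 : Tendsto (fun M : ℕ => ENNReal.ofReal (1 + (M : ℝ)⁻¹)) atTop (𝓝 1) := by
      simpa using ENNReal.tendsto_ofReal (hinv.const_add 1)
    have h3 := h1.add (ENNReal.Tendsto.mul_const (b := (m : ℝ≥0∞) ^ (p⁻¹).toReal * L) h2
      (Or.inl one_ne_zero))
    rw [one_mul, zero_add] at h3
    exact ge_of_tendsto h3 (eventually_atTop.mpr ⟨1, hbound⟩)
  -- The bound for all `L` above the modulus passes to the limit from the right, which needs a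
  -- finite modulus.
  by_cases htop : kMinus p τ = ∞
  · have hm' : (m : ℝ≥0∞) ^ (p⁻¹).toReal ≠ 0 := by
      rw [Ne, ENNReal.rpow_eq_zero_iff]
      have : (m : ℝ≥0∞) ≠ 0 := by exact_mod_cast (by omega : m ≠ 0)
      simp [this]
    rw [htop, ENNReal.mul_top hm']
    exact le_top
  · have hlim : Tendsto (fun L => (m : ℝ≥0∞) ^ (p⁻¹).toReal * L) (𝓝[>] (kMinus p τ))
        (𝓝 ((m : ℝ≥0∞) ^ (p⁻¹).toReal * kMinus p τ)) :=
      (ENNReal.Tendsto.const_mul tendsto_id (Or.inr hmpow)).mono_left nhdsWithin_le_nhds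
    have : (𝓝[>] (kMinus p τ)).NeBot := nhdsGT_neBot_of_exists_gt ⟨∞, lt_top_iff_ne_top.mpr htop⟩
    exact ge_of_tendsto hlim (eventually_nhdsWithin_of_forall hmain)

end QuasicentralModulus

end

theorem theorem3p1 {H : Type*} [NormedAddCommGroup H] [InnerProductSpace ℂ H] [CompleteSpace H]
    [TopologicalSpace.SeparableSpace H] {n : ℕ} (τ : Fin n → H →L[ℂ] H)
    (p : ENNReal) (hp : 1 ≤ p) (m : ℕ) (hm : 1 ≤ m) :
    QuasicentralModulus.kMinus p (fun i => QuasicentralModulus.ampliation m (τ i)) =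
      (m : ENNReal) ^ (p⁻¹).toReal * QuasicentralModulus.kMinus p τ :=
  le_antisymm (QuasicentralModulus.kMinus_ampliation_le hp τ hm)
    (QuasicentralModulus.rpow_mul_kMinus_le hp τ hm)
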